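/- **Setting.** Let $D\subset\mathbb{C}$ be the closed unit disk with base point $\ast_D=1$, and let $\pi:E\to D$ be a Lefschetz fibration with closed fibres: $E$ is a compact connected oriented smooth $4$-manifold with boundary, $\pi$ is smooth, $\pi^{-1}(\partial D)=\partial E$, and every critical point is interior and has the local form $\pi=z_1^2+z_2^2$ in complex coordinates compatible with the orientations. Let $p_1,\dots,p_k$ be the critical points, lying in distinct fibres, and let $\Sigma\cong\pi^{-1}(\ast_D)$ be the regular fibre, a closed connected surface with base point $\ast_\Sigma$. For a simple closed curve $V\subset\Sigma$ with annular neighbourhood $N(V)\cong S^1\times[0,1]$, $V=S^1\times\{1/2\}$, whose interior does not contain $\ast_\Sigma$, let $\tau_V$ be the Dehn twist $(u,v)\mapsto(ue^{2\pi i v},v)$ on $N(V)$, extended by the identity. Let $\widetilde V$ be the following based representative of $V$: an arc in $\Sigma\setminus\operatorname{int}N(V)$ from $\ast_\Sigma$ to the boundary curve $S^1\times\{0\}$ of $N(V)$, then $t\mapsto(e^{2\pi i t},0)$, then the arc backwards. (Coordinates are chosen so that such an arc exists; replacing $(u,v)$ by $(\bar u,1-v)$ does not change $\tau_V$.) A *compatible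 factorization* $\tau=\tau_{V_k}\circ\cdots\circ\tau_{V_1}$ of the monodromy consists of curves $V_1,\dots,V_k$ as above and of the following data. There are closed disks $D_i\subset D$ centred at the critical values $\pi(p_i)$, which meet each other and $\partial D$ only in $\ast_D$. Over each $D_i$, with polar coordinates $re^{2\pi it}$ in which $\ast_D$ is $1$, there are parallel transport maps from $\Sigma$ onto the fibres, depending continuously on $(r,t)$, which start at the identification $\Sigma\cong\pi^{-1}(\ast_D)$, are bijective for $r>0$, at $r=0$ collapse exactly $V_i$ to $p_i$ and are injective elsewhere, do not depend on $t$ at $r=0$ outside $\operatorname{int}N(V_i)$, and have monodromy $\tau_{V_i}$ in $t$. The closure of $D\setminus\bigcup_iD_i$, cut open at $\ast_D$, is a disk bounded by $\partial D$ and by the concatenation $\partial D_1\star\cdots\star\partial D_k$, and $\pi$ is trivialized over it compatibly with these transports. This identifies $\pi^{-1}(\partial D)$ with the mapping torus $\Sigma_\tau=\Sigma\times[0,1]/(x,1)\sim(\tau(x),0)$. In $\pi_1(\Sigma_\tau,\ast_\Sigma)\cong\pi_1(\Sigma,\ast_\Sigma)\rtimes\mathbb{Z}$ the element $([\alpha],1)$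 is the class of the loop $\alpha$ in the fibre followed by the horizontal loop $t\mapsto[\ast_\Sigma,t]$. **Theorem.** Let $\tau=\tau_{V_k}\circ\cdots\circ\tau_{V_1}$ be a compatible factorization, $\alpha$ a loop in $\Sigma$ based at $\ast_\Sigma$, and $s_\alpha$ a continuous section of $\pi$ over $\partial D$ that represents $([\alpha],1)\in\pi_1(\Sigma_\tau,\ast_\Sigma)$. Consider decompositions $$\alpha\simeq\alpha_1\star\tau_{V_1}^{-1}\alpha_2\star\cdots\star(\tau_{V_{k-1}}\circ\cdots\circ\tau_{V_1})^{-1}\alpha_k,\qquad \alpha_i\simeq\zeta_i\star\widetilde V_i^{\,m_i}\star\tau_{V_i}^{-1}(\overline{\zeta_i}),\qquad(\ast)$$ with based loops $\alpha_i,\zeta_i$ in $\Sigma$ and integers $m_i$, where $\simeq$ is homotopy of based loops. 1. $s_\alpha$ extends to a continuous section of $\pi$ over $D$ if and only if $\alpha$ has a decomposition $(\ast)$. 2. $s_\alpha$ extends to a continuous section over $D$ that is smoothable, i.e. homotopic through continuous sections to a smooth section, if and only if $\alpha$ has a decomposition $(\ast)$ with $m_i\in\{0,1\}$ for all $i$.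 3. If $s_\alpha$ is smooth, then $s_\alpha$ extends to a smooth section over $D$ if and only if $\alpha$ has a decomposition $(\ast)$ with $m_i\in\{0,1\}$ for all $i$. -/

import Mathlib

open scoped Manifold ContDiff unitInterval

noncomputable section

namespace Lefschetz

/-! ### Oriented 4-manifolds with boundary and Lefschetz fibrations over the closed unit disk -/

section Fibration

variable {E : Type*} [TopologicalSpace E] [ChartedSpace (EuclideanHalfSpace 4) E]

/-- Two charts of a `4`-manifold with boundary induce the same orientation on the overlap of their
domains: the coordinate change has positive Jacobian determinant. -/
def SameOrientation (e e' : OpenPartialHomeomorph E (EuclideanHalfSpace 4)) : Prop :=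
  ∀ x ∈ e.source ∩ e'.source,
    0 < (fderivWithin ℝ ((e'.extend (𝓡∂ 4)) ∘ (e.extend (𝓡∂ 4)).symm)
      (Set.range (𝓡∂ 4)) (e.extend (𝓡∂ 4) x)).det

variable (E) in
/-- An orientation of a smooth `4`-manifold with boundary, given by an oriented atlas. -/
structure OrientedAtlas where
  charts : Set (OpenPartialHomeomorph E (EuclideanHalfSpace 4))
  smooth : charts ⊆ IsManifold.maximalAtlas (𝓡∂ 4) ∞ E
  cover : ∀ x : E, ∃ e ∈ charts, x ∈ e.source
  oriented : ∀ e ∈ charts, ∀ e' ∈ charts, SameOrientation e e'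

/-- `x` is a critical point of `π : E → ℂ`. -/
def IsCritical (π : E → ℂ) (x : E) : Prop :=
  ¬ Function.Surjective (mfderiv (𝓡∂ 4) 𝓘(ℝ, ℂ) π x)

/-- The complex coordinates `(z₁, z₂) = (x₀ + i x₁, x₂ + i x₃)`, centred at `p`, that a chart `e`
provides. -/
def complexCoord (e : OpenPartialHomeomorph E (EuclideanHalfSpace 4)) (p y : E) : ℂ × ℂ :=
  let v := e.extend (𝓡∂ 4) y - e.extend (𝓡∂ 4) p
  (⟨v 0, v 1⟩, ⟨v 2, v 3⟩)

/-- A Lefschetz fibration with closed fibres `π : E → D` over the closed unit disk `D ⊆ ℂ`: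
a smooth map with `π⁻¹(∂D) = ∂E`, whose critical points are interior and have the local form
`z₁² + z₂²` in complex coordinates compatible with the orientations of `E` and of `ℂ`. -/
structure IsLefschetzFibration (A : OrientedAtlas E) (π : E → ℂ) : Prop where
  smooth : ContMDiff (𝓡∂ 4) 𝓘(ℝ, ℂ) ∞ π
  mem_disk : ∀ x, ‖π x‖ ≤ 1
  boundary : ∀ x, ‖π x‖ = 1 ↔ x ∈ (𝓡∂ 4).boundary E
  critical_interior : ∀ p, IsCritical π p → p ∈ (𝓡∂ 4).interior E
  local_model : ∀ p, IsCritical π p →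
    ∃ e ∈ IsManifold.maximalAtlas (𝓡∂ 4) ∞ E, p ∈ e.source ∧
      (∀ e' ∈ A.charts, SameOrientation e e') ∧
      ∃ c : OpenPartialHomeomorph ℂ ℂ, π p ∈ c.source ∧ c (π p) = 0 ∧
        ContDiffOn ℝ ∞ c c.source ∧ ContDiffOn ℝ ∞ c.symm c.target ∧
        (∀ z ∈ c.source, 0 < (fderiv ℝ c z).det) ∧
        ∀ y ∈ e.source, π y ∈ c.source ∧
          c (π y) = (complexCoord e p y).1 ^ 2 + (complexCoord e p y).2 ^ 2

/-- `φ` is a continuous section of `π` over the closed unit disk (only the values of `φ` on the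
disk matter). -/
def IsContinuousSection (π : E → ℂ) (φ : ℂ → E) : Prop :=
  ContinuousOn φ (Metric.closedBall 0 1) ∧ ∀ z ∈ Metric.closedBall (0 : ℂ) 1, π (φ z) = z

/-- `φ` is a smooth section of `π` over the closed unit disk (up to the boundary). -/
def IsSmoothSection (π : E → ℂ) (φ : ℂ → E) : Prop :=
  ContMDiffOn 𝓘(ℝ, ℂ) (𝓡∂ 4) ∞ φ (Metric.closedBall 0 1) ∧
    ∀ z ∈ Metric.closedBall (0 : ℂ) 1, π (φ z) = z

/-- `φ` is homotopic, through continuous sections over the disk, to a smooth section. -/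
def IsSmoothable (π : E → ℂ) (φ : ℂ → E) : Prop :=
  ∃ K : I × ℂ → E, ContinuousOn K (Set.univ ×ˢ Metric.closedBall 0 1) ∧
    (∀ t : I, ∀ z ∈ Metric.closedBall (0 : ℂ) 1, π (K (t, z)) = z) ∧
    (∀ z ∈ Metric.closedBall (0 : ℂ) 1, K (0, z) = φ z) ∧
    IsSmoothSection π (fun z => K (1, z))

/-- `φ` extends the section `s` given over the boundary circle. -/
def Extends (φ : ℂ → E) (s : Circle → E) : Prop :=
  ∀ z : Circle, φ z = s z

end Fibration

/-! ### Loops -/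

section Loops

variable {S : Type*} [TopologicalSpace S] {b : S}

/-- The power `γ ^ m` of a based loop, `m` an integer. -/
def loopPow (γ : Path b b) : ℤ → Path b b
  | Int.ofNat n => Nat.rec (Path.refl b) (fun _ p => p.trans γ) n
  | Int.negSucc n => Nat.rec (Path.refl b) (fun _ p => p.trans γ.symm) (n + 1)

/-- The loop `g⁻¹ ∘ α`, for a homeomorphism `g` that fixes the base point. -/
def pullLoop (g : S ≃ₜ S) (h : g b = b) (α : Path b b) : Path b b :=
  (α.map g.symm.continuous).cast (by rw [Homeomorph.eq_symm_apply, h])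
    (by rw [Homeomorph.eq_symm_apply, h])

/-- The concatenation `β₀ ⋆ β₁ ⋆ ⋯ ⋆ βₙ₋₁` (the constant loop if `n = 0`). -/
def concatLoops {n : ℕ} (β : Fin n → Path b b) : Path b b :=
  (List.ofFn β).foldr Path.trans (Path.refl b)

end Loops

/-! ### Dehn twists and mapping tori -/

section Surface

variable {S : Type*} [TopologicalSpace S]

/-- The point `e^{2πit}` of the circle. -/
def circ (t : ℝ) : Circle := Circle.exp (2 * Real.pi * t)

/-- The open annulus `S¹ × (0,1)`. -/
def openAnnulus : Set (Circle × I) := {p | 0 < (p.2 : ℝ) ∧ (p.2 : ℝ) < 1}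

/-- A simple closed curve `V` in a surface `S` with base point `b`, together with an annular
neighbourhood `S¹ × [0,1] ↪ S` of `V = S¹ × {1/2}`, the Dehn twist `(u,v) ↦ (u e^{2πiv}, v)`
supported in that neighbourhood, and an arc that joins the base point to the boundary curve
`S¹ × {0}` outside the open annulus. -/
structure Curve (b : S) where
  annulus : Circle × I → S
  annulus_continuous : Continuous annulus
  annulus_injective : Function.Injective annulus
  isOpen_annulus : IsOpen (annulus '' openAnnulus)
  base_notMem : b ∉ annulus '' openAnnulus
  twist : S ≃ₜ S
  twist_annulus : ∀ (u : Circle) (v : I), twist (annulus (u, v)) = annulus (u * circ v, v)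
  twist_off : ∀ x, x ∉ Set.range annulus → twist x = x
  arc : Path b (annulus (1, 0))
  arc_notMem : ∀ t, arc t ∉ annulus '' openAnnulus

namespace Curve

variable {b : S} (V : Curve b)

/-- The curve itself. -/
def core : Set S := V.annulus '' {p | (p.2 : ℝ) = 1 / 2}

theorem circ_zero : circ 0 = 1 := by simp [circ]

theorem circ_one : circ 1 = 1 := by simp [circ]

theorem twist_base : V.twist b = b := by
  by_cases hb : b ∈ Set.range V.annulus
  · obtain ⟨⟨u, v⟩, hb⟩ := hb
    have hv : ¬ (0 < (v : ℝ) ∧ (v : ℝ) < 1) := fun h => V.base_notMem ⟨(u, v), h, hb⟩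
    suffices V.annulus (u * circ v, v) = V.annulus (u, v) by
      rw [← V.twist_annulus, hb] at this
      exact this
    have : (v : ℝ) = 0 ∨ (v : ℝ) = 1 := by
      by_contra! h
      exact hv ⟨lt_of_le_of_ne v.2.1 (Ne.symm h.1), lt_of_le_of_ne v.2.2 h.2⟩
    rcases this with h | h <;> rw [h] <;> simp [circ_zero, circ_one]
  · exact V.twist_off b hb

/-- The boundary curve `t ↦ (e^{2πit}, 0)` of the annular neighbourhood. -/
def pushOff : Path (V.annulus (1, 0)) (V.annulus (1, 0)) where
  toFun t := V.annulus (circ t, 0)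
  continuous_toFun := by
    refine V.annulus_continuous.comp (Continuous.prodMk ?_ continuous_const)
    exact Circle.exp.continuous.comp (by fun_prop)
  source' := by simp [circ_zero]
  target' := by simp [circ_one]

/-- The based representative of the curve: go along the arc to the boundary of the
annular neighbourhood, once around it with the neighbourhood on the left
(for the orientation `(u, v)` of the annulus), and back. -/
def basedLoop : Path b b := (V.arc.trans V.pushOff).trans V.arc.symm

end Curve

/-- `τ_{n-1} ∘ ⋯ ∘ τ₀` (where only `τ_i` with `i < k` count). -/
def partialTwist {k : ℕ} (τ : Fin k → S ≃ₜ S) : ℕ → S ≃ₜ S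
  | 0 => Homeomorph.refl S
  | n + 1 => (partialTwist τ n).trans (if h : n < k then τ ⟨n, h⟩ else Homeomorph.refl S)

theorem partialTwist_base {k : ℕ} {b : S} (τ : Fin k → S ≃ₜ S) (h : ∀ i, τ i b = b) (n : ℕ) :
    partialTwist τ n b = b := by
  induction n with
  | zero => rfl
  | succ n ih =>
    simp only [partialTwist, Homeomorph.trans_apply, ih]
    split_ifs with hn
    · exact h _
    · rfl

/-- The gluing relation `(x, 1) ∼ (f x, 0)` of the mapping torus. -/
inductive MappingTorusRel (f : S → S) : S × I → S × I → Prop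
  | glue (x : S) : MappingTorusRel f (x, 1) (f x, 0)

/-- The mapping torus `S × [0,1] / (x, 1) ∼ (f x, 0)`. -/
def MappingTorus (f : S → S) : Type _ := Quot (MappingTorusRel f)

instance (f : S → S) : TopologicalSpace (MappingTorus f) :=
  inferInstanceAs (TopologicalSpace (Quot (MappingTorusRel f)))

namespace MappingTorus

variable (f : S → S)

def mk (x : S) (t : I) : MappingTorus f := Quot.mk _ (x, t)

theorem continuous_mk : Continuous fun p : S × I => mk f p.1 p.2 := continuous_quot_mk

variable {f} {b : S}

/-- A loop of `S`, seen in the fibre over `0` of the mapping torus. -/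
def fibreLoop (α : Path b b) : Path (mk f b 0) (mk f b 0) :=
  α.map (f := fun x => mk f x 0)
    ((continuous_mk f).comp (by fun_prop : Continuous fun x : S => (x, (0 : I))))

/-- The horizontal loop swept by a fixed point. -/
def horizontal (h : f b = b) : Path (mk f b 0) (mk f b 0) where
  toFun t := mk f b t
  continuous_toFun := (continuous_mk f).comp (by fun_prop : Continuous fun t : I => (b, t))
  source' := rfl
  target' := by
    have : mk f b 1 = mk f (f b) 0 := Quot.sound (MappingTorusRel.glue b)
    rw [this, h]

/-- The representative of `([α], 1)` in `π₁(S_f) = π₁(S) ⋊ ℤ`: the loop `α` in the fibre,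
followed by the horizontal loop. -/
def loopOne (h : f b = b) (α : Path b b) : Path (mk f b 0) (mk f b 0) :=
  (fibreLoop α).trans (horizontal h)

end MappingTorus

end Surface

/-! ### Factorizations of the monodromy -/

/-- A factorization `τ = τ_{V_{k-1}} ∘ ⋯ ∘ τ_{V_0}` of the monodromy that is compatible with the
Lefschetz fibration `π : E → D`, with base point `1 ∈ ∂D` and fibre `S` over it.

It comes from a bouquet of closed disks `D_i ⊆ D`, one around each critical value, that meet each
other and `∂D` only in the base point. Over `D_i`, parallel transport along the rays and around
the centre identifies the fibres with `S`; the curve `V_i` shrinks to the critical point along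
every ray, the fibration is a product outside the annular neighbourhood of `V_i`, and the
monodromy around `∂D_i` is the Dehn twist along `V_i`. Over the rest of `D`, which is cut open
into a square along the bouquet, the fibration is trivialized; this gives the identification of
`π⁻¹(∂D)` with the mapping torus of `τ`. -/
structure Factorization {E : Type*} [TopologicalSpace E] [ChartedSpace (EuclideanHalfSpace 4) E]
    (π : E → ℂ) (S : Type*) [TopologicalSpace S] (b : S) (k : ℕ) where
  /-- the critical points -/
  crit : Fin k → E
  range_crit : Set.range crit = {x | IsCritical π x}
  /-- the vanishing cycles -/
  V : Fin k → Curve b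
  /-- the identification of `S` with the fibre over the base point -/
  fibre : S → E
  -- The bouquet of disks.
  disk : Fin k → ℂ → ℂ
  disk_continuousOn : ∀ i, ContinuousOn (disk i) (Metric.closedBall 0 1)
  disk_injOn : ∀ i, Set.InjOn (disk i) (Metric.closedBall 0 1)
  disk_zero : ∀ i, disk i 0 = π (crit i)
  disk_one : ∀ i, disk i 1 = 1
  disk_interior : ∀ i, ∀ w ∈ Metric.closedBall (0 : ℂ) 1, w ≠ 1 → ‖disk i w‖ < 1
  disk_disjoint : ∀ i j, i ≠ j → ∀ w ∈ Metric.closedBall (0 : ℂ) 1,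
    ∀ w' ∈ Metric.closedBall (0 : ℂ) 1, disk i w = disk j w' → w = 1 ∧ w' = 1
  -- Parallel transport over the disks: `transport i (r, t, x)` lies over the point `r e^{2πit}`
  -- of the `i`-th disk.
  transport : Fin k → I × I × S → E
  transport_continuous : ∀ i, Continuous (transport i)
  transport_proj : ∀ i (r t : I) x, π (transport i (r, t, x)) = disk i ((r : ℝ) * circ t)
  transport_surj : ∀ i (r t : I) y, π y = disk i ((r : ℝ) * circ t) →
    ∃ x, transport i (r, t, x) = y
  transport_inj : ∀ i (r t : I), r ≠ 0 → Function.Injective fun x => transport i (r, t, x)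
  transport_base : ∀ i x, transport i (1, 0, x) = fibre x
  transport_monodromy : ∀ i (r : I) x,
    transport i (r, 1, x) = transport i (r, 0, (V i).twist x)
  transport_flat : ∀ i (t : I) x, x ∉ (V i).annulus '' openAnnulus →
    transport i (0, t, x) = transport i (0, 0, x)
  transport_vanishing : ∀ i (t : I) x, transport i (0, t, x) = crit i ↔ x ∈ (V i).core
  transport_inj_off : ∀ i (t : I),
    Set.InjOn (fun x => transport i (0, t, x)) (V i).coreᶜ
  -- The trivialization over the complement of the disks, cut open into a square: the side `s = 0`
  -- runs along `∂D`, the side `s = 1` along `∂D_0`, …, `∂D_{k-1}`, and the other two sides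
  -- are collapsed to the base point.
  square : I × I → ℂ
  square_boundary : ∀ t : I, square (0, t) = circ t
  square_inj : ∀ p q, square p = square q → square p ≠ 1 → p = q
  square_eq_one : ∀ s t : I, square (s, t) = 1 → s = 1 ∨ t = 0 ∨ t = 1
  square_disk : ∀ s t : I, s ≠ 1 → t ≠ 0 → t ≠ 1 →
    ∀ i, square (s, t) ∉ disk i '' Metric.closedBall 0 1
  square_cover : ∀ z ∈ Metric.closedBall (0 : ℂ) 1,
    z ∈ Set.range square ∨ ∃ i, z ∈ disk i '' Metric.closedBall 0 1
  triv : I × I × S → E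
  triv_continuous : Continuous triv
  triv_proj : ∀ s t x, π (triv (s, t, x)) = square (s, t)
  triv_surj : ∀ s t y, π y = square (s, t) → ∃ x, triv (s, t, x) = y
  triv_inj : ∀ s t, Function.Injective fun x => triv (s, t, x)
  triv_left : ∀ s x, triv (s, 0, x) = fibre x
  triv_right : ∀ s x,
    triv (s, 1, x) = fibre (partialTwist (fun j => (V j).twist) k x)
  triv_disks : ∀ (i : Fin k) (t u : I) x, (u : ℝ) * k = (i : ℕ) + (t : ℝ) →
    triv (1, u, x) = transport i (1, t, partialTwist (fun j => (V j).twist) i x)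
  triv_disks_of_zero : k = 0 → ∀ t x, triv (1, t, x) = fibre x
  /-- the identification of `π⁻¹(∂D)` with the mapping torus -/
  boundaryIso : MappingTorus (partialTwist (fun j => (V j).twist) k) ≃ₜ {y : E // ‖π y‖ = 1}
  boundaryIso_mk : ∀ x t, (boundaryIso (MappingTorus.mk _ x t) : E) = triv (0, t, x)

namespace Factorization

variable {E : Type*} [TopologicalSpace E] [ChartedSpace (EuclideanHalfSpace 4) E]
  {π : E → ℂ} {S : Type*} [TopologicalSpace S] {b : S} {k : ℕ} (F : Factorization π S b k)

/-- `τ_{V_{n-1}} ∘ ⋯ ∘ τ_{V_0}`. -/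
def twists (n : ℕ) : S ≃ₜ S := partialTwist (fun j => (F.V j).twist) n

theorem twists_base (n : ℕ) : F.twists n b = b :=
  partialTwist_base _ (fun i => (F.V i).twist_base) n

/-- The monodromy `τ = τ_{V_{k-1}} ∘ ⋯ ∘ τ_{V_0}`. -/
def monodromy : S ≃ₜ S := F.twists k

/-- The section `s` of `π` over `∂D` represents `([α], 1)` in the fundamental group of
the mapping torus of the monodromy. -/
def Represents (s : Circle → E) (α : Path b b) : Prop :=
  ∃ p : Path (MappingTorus.mk F.monodromy b 0) (MappingTorus.mk F.monodromy b 0),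
    (∀ t : I, (F.boundaryIso (p t) : E) = s (circ t)) ∧
    p.Homotopic (MappingTorus.loopOne (F.twists_base k) α)

/-- `α ≃ α_0 ⋆ τ_{V_0}⁻¹ α_1 ⋆ ⋯ ⋆ (τ_{V_{k-2}} ∘ ⋯ ∘ τ_{V_0})⁻¹ α_{k-1}`, where
`α_i ≃ ζ_i ⋆ Ṽ_i ^ m_i ⋆ τ_{V_i}⁻¹ (ζ_i reversed)` for based loops `ζ_i` and integers `m_i ∈ M`. -/
def Decomposes (α : Path b b) (M : Set ℤ) : Prop :=
  ∃ (m : Fin k → ℤ) (ζ β : Fin k → Path b b),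
    (∀ i, m i ∈ M) ∧
    (∀ i, (β i).Homotopic (((ζ i).trans (loopPow (F.V i).basedLoop (m i))).trans
      (pullLoop (F.V i).twist (F.V i).twist_base (ζ i).symm))) ∧
    α.Homotopic (concatLoops fun i => pullLoop (F.twists i) (F.twists_base i) (β i))

end Factorization

end Lefschetz

end

/-! Over a disk `D_i`, parallel transport turns a section into a family of paths `X (r, ·)` in `S`
with `τ (X (r, 1)) = X (r, 0)`, where `τ` is the Dehn twist along `V_i`. So a section over `∂D_i` is
a twisted loop, and it extends over `D_i` exactly when it is homotopic, through twisted loops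
(`TwistHomotopic`), to one that closes up at the centre `r = 0`.

Inside the annulus a twisted loop `(θ, v)` has the integer invariant `m = θ(1) + v(0) - θ(0)` and
can be pushed to the loop that winds `m` times around `S¹ × {0}` (`Curve.twistHomotopic_wind`). If
the section passes through the critical point, its twisted loop on a small circle lies in the
annulus, and any `m` may occur, since the core curve collapses. If it avoids the critical point, the
loop at the centre can be moved within the singular fibre until it is constant on one of the two
boundary curves of the annulus; the constant loop at height `j` has invariant `j`, so `m` can be
taken in `{0, 1}`. Both constructions reverse. In based terms, being twisted homotopic to `m`
windings means being of the form `ζ ⋆ Ṽ^m ⋆ τ⁻¹(ζ̄)` (`Curve.exists_conj_loopPow_iff`).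

Over the complementary square the fibration is trivial, so a section there is a homotopy from the
loop on `∂D` to the concatenation of the loops on the `∂D_i`, each pulled back by the preceding
twists. The loop on `∂D` is homotopic to `α` by lifting to the infinite cyclic covering of the
mapping torus (`exists_boundary_path`). The two directions are `decomposes_of_sectionHomotopic` and
`exists_section_of_decomposes`.

For smoothness, differentiating `π ∘ φ = id` shows that a smooth section avoids critical points.
Conversely, away from critical points `π` is a projection in suitable coordinates, also at the
boundary, so a continuous section that avoids them can be smoothed ball by ball, keeping smooth
boundary values (`exists_isSmoothSection`). -/

noncomputable section
namespace Lefschetz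

open Set Metric Filter Topology

/-! ### Inverse function theorem for convex domains with boundary -/

section InverseFunction

variable {X W : Type*} [NormedAddCommGroup X] [NormedSpace ℝ X]
  [NormedAddCommGroup W] [NormedSpace ℝ W]

/-- A continuous right inverse of a smooth map with invertible derivatives is smooth, relative to
sets with unique derivatives. -/
theorem contDiffOn_of_right_inverse [CompleteSpace X] {s : Set X} {N : Set W} {G : X → W}
    {Ψ : W → X} (hs : UniqueDiffOn ℝ s) (hN : UniqueDiffOn ℝ N) (hG : ContDiffOn ℝ ∞ G s)
    (hinv : ∀ w ∈ N, ∃ e : X ≃L[ℝ] W, fderivWithin ℝ G s (Ψ w) = e)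
    (hΨ : ContinuousOn Ψ N) (hmaps : MapsTo Ψ N s) (hright : ∀ w ∈ N, G (Ψ w) = w) :
    ContDiffOn ℝ ∞ Ψ N := by
  -- A continuous inverse of a map with invertible derivative is differentiable, with the inverse
  -- derivative.
  have hder : ∀ w ∈ N, HasFDerivWithinAt Ψ
      (ContinuousLinearMap.inverse (fderivWithin ℝ G s (Ψ w))) N w := by
    intro w hw
    obtain ⟨e, he⟩ := hinv w hw
    have h1 : HasFDerivWithinAt G (e : X →L[ℝ] W) s (Ψ w) := by
      rw [← he]
      exact ((hG.differentiableOn (by simp)) _ (hmaps hw)).hasFDerivWithinAt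
    rw [he, ContinuousLinearMap.inverse_equiv]
    refine h1.of_local_left_inverse ?_ hw ?_
    · exact tendsto_nhdsWithin_iff.2 ⟨hΨ w hw, eventually_mem_nhdsWithin.mono fun y hy => hmaps hy⟩
    · exact eventually_mem_nhdsWithin.mono hright
  have hD : ContDiffOn ℝ ∞ (fderivWithin ℝ G s) s := hG.fderivWithin hs (by simp)
  rw [contDiffOn_infty]
  intro n
  induction n with
  | zero => exact contDiffOn_zero.2 hΨ
  | succ n ih =>
    rw [show ((n + 1 : ℕ) : WithTop ℕ∞) = (n : WithTop ℕ∞) + 1 by norm_cast,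
      contDiffOn_succ_iff_fderivWithin hN]
    refine ⟨fun w hw => (hder w hw).differentiableWithinAt, by simp, ?_⟩
    -- Bootstrapping: the derivative of `Ψ` is inversion composed with the derivative of `G` along
    -- `Ψ`, hence as regular as `Ψ` is already known to be.
    have : ContDiffOn ℝ n (fun w => ContinuousLinearMap.inverse (fderivWithin ℝ G s (Ψ w))) N := by
      intro w hw
      obtain ⟨e, he⟩ := hinv w hw
      have h2 : ContDiffWithinAt ℝ n (fun w => fderivWithin ℝ G s (Ψ w)) N w :=
        ((hD.of_le (by exact_mod_cast le_top)) _ (hmaps hw)).comp w (ih w hw) hmaps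
      have h3 : ContDiffAt ℝ n ContinuousLinearMap.inverse (fderivWithin ℝ G s (Ψ w)) := by
        rw [he]
        exact contDiffAt_map_inverse e
      exact h3.comp_contDiffWithinAt w h2
    exact this.congr fun w hw => (hder w hw).fderivWithin (hN w hw)

/-- The inverse function theorem for a smooth map between convex sets with nonempty interior that
maps the interior to the interior and the boundary to the boundary. -/
theorem exists_contDiffOn_local_inverse [FiniteDimensional ℝ W] {H : Set X} {C : Set W}
    (hHc : Convex ℝ H) (hHcl : IsClosed H) (hHi : (interior H).Nonempty)
    (hCc : Convex ℝ C) (hCi : (interior C).Nonempty) {G : X → W} {x₀ : X} {r : ℝ} (hr : 0 < r)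
    (hx₀ : x₀ ∈ H) (hG : ContDiffOn ℝ ∞ G (H ∩ ball x₀ r)) (G' : X ≃L[ℝ] W)
    (hG' : HasFDerivWithinAt G (G' : X →L[ℝ] W) H x₀)
    (hint : ∀ x ∈ H ∩ ball x₀ r, (x ∈ interior H ↔ G x ∈ interior C)) :
    ∃ ρ > 0, ∃ r' ∈ Ioc 0 r, ∃ Ψ : W → X, ContDiffOn ℝ ∞ Ψ (C ∩ ball (G x₀) ρ) ∧
      (∀ w ∈ C ∩ ball (G x₀) ρ, Ψ w ∈ H ∩ ball x₀ r' ∧ G (Ψ w) = w) ∧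
      ∀ x ∈ H ∩ ball x₀ r', Ψ (G x) = x := by
  have : FiniteDimensional ℝ X := G'.symm.finiteDimensional
  set s₀ : Set X := H ∩ ball x₀ r with hs₀
  have hus : UniqueDiffOn ℝ s₀ := (uniqueDiffOn_convex hHc hHi).inter isOpen_ball
  have hx₀s : x₀ ∈ s₀ := ⟨hx₀, mem_ball_self hr⟩
  have hDc : ContinuousOn (fderivWithin ℝ G s₀) s₀ := hG.continuousOn_fderivWithin hus (by simp)
  have hD0 : fderivWithin ℝ G s₀ x₀ = G' :=
    (hG'.mono inter_subset_left).fderivWithin (hus _ hx₀s)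
  -- A bound for `G - G'` in the Lipschitz sense that is small enough for `G` to extend from a part
  -- of `H` to a homeomorphism of the whole space; the extension constant is the price of extending
  -- Lipschitz maps with values in `W`.
  obtain ⟨c, hc0, hc⟩ : ∃ c : NNReal, 0 < c ∧
      (Subsingleton X ∨ lipschitzExtensionConstant W * c < ‖(G'.symm : W →L[ℝ] X)‖₊⁻¹) := by
    rcases subsingleton_or_nontrivial X with h | h
    · exact ⟨1, one_pos, Or.inl h⟩
    have hL : 0 < lipschitzExtensionConstant W := lipschitzExtensionConstant_pos W
    have hn : 0 < ‖(G'.symm : W →L[ℝ] X)‖₊⁻¹ := by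
      have := G'.subsingleton_or_nnnorm_symm_pos.resolve_left (not_subsingleton X)
      exact inv_pos.2 this
    obtain ⟨c, hc, hc'⟩ := exists_between (div_pos hn hL)
    exact ⟨c, hc, Or.inr ((lt_div_iff₀' hL).1 hc')⟩
  obtain ⟨r₁, hr₁, hr₁r, hr₁D, hr₁e⟩ : ∃ r₁ > 0, r₁ ≤ r ∧
      (∀ x ∈ H ∩ ball x₀ r₁, ‖fderivWithin ℝ G s₀ x - G'‖ ≤ c) ∧
      (∀ x ∈ H ∩ ball x₀ r₁, ∃ e : X ≃L[ℝ] W, fderivWithin ℝ G s₀ x = e) := by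
    have h1 : ∀ᶠ x in 𝓝[s₀] x₀, ‖fderivWithin ℝ G s₀ x - G'‖ ≤ c := by
      have := (hDc x₀ hx₀s).sub (continuousWithinAt_const (b := (G' : X →L[ℝ] W)))
      have h0 := this.norm.tendsto
      simp only [Pi.sub_apply, hD0, sub_self, norm_zero] at h0
      exact (h0.eventually (gt_mem_nhds (NNReal.coe_pos.2 hc0))).mono fun x hx => le_of_lt hx
    have h2 : ∀ᶠ x in 𝓝[s₀] x₀, ∃ e : X ≃L[ℝ] W, fderivWithin ℝ G s₀ x = e := by
      have h3 := ContinuousLinearEquiv.nhds G'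
      rw [← hD0] at h3
      filter_upwards [(hDc x₀ hx₀s).tendsto.eventually h3] with x hx
      obtain ⟨e, he⟩ := hx
      exact ⟨e, he.symm⟩
    obtain ⟨δ, hδ, hball⟩ := Metric.mem_nhdsWithin_iff.1 (h1.and h2)
    refine ⟨min δ r, lt_min hδ hr, min_le_right _ _, fun x hx => ?_, fun x hx => ?_⟩
    · exact (hball ⟨ball_subset_ball (min_le_left _ _) hx.2, hx.1,
        ball_subset_ball (min_le_right _ _) hx.2⟩).1
    · exact (hball ⟨ball_subset_ball (min_le_left _ _) hx.2, hx.1,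
        ball_subset_ball (min_le_right _ _) hx.2⟩).2
  set s : Set X := H ∩ ball x₀ r₁ with hs
  have hss : s ⊆ s₀ := inter_subset_inter_right _ (ball_subset_ball hr₁r)
  have happ : ApproximatesLinearOn G (G' : X →L[ℝ] W) s c := by
    refine LipschitzOnWith.approximatesLinearOn ?_
    refine Convex.lipschitzOnWith_of_nnnorm_hasFDerivWithin_le
      (f' := fun x => fderivWithin ℝ G s₀ x - (G' : X →L[ℝ] W)) (fun x hx => ?_) (fun x hx => ?_)
      (hHc.inter (convex_ball _ _))
    · exact ((hG.differentiableOn (by simp) x (hss hx)).hasFDerivWithinAt.mono hss).sub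
        (G' : X →L[ℝ] W).hasFDerivWithinAt
    · exact hr₁D x hx
  obtain ⟨g, hg⟩ := happ.exists_homeomorph_extension hc
  have hx₀s' : x₀ ∈ s := ⟨hx₀, mem_ball_self hr₁⟩
  have hgx₀ : g.symm (G x₀) = x₀ := by rw [hg hx₀s', g.symm_apply_apply]
  obtain ⟨ρ, hρ, hball⟩ : ∃ ρ > 0, ball (G x₀) ρ ⊆ g.symm ⁻¹' ball x₀ r₁ := by
    apply Metric.mem_nhds_iff.1
    apply g.symm.continuous.continuousAt.preimage_mem_nhds
    rw [hgx₀]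
    exact ball_mem_nhds _ hr₁
  have hclH : closure (interior H) = H := by
    rw [hHc.closure_interior_eq_closure_of_nonempty_interior hHi, hHcl.closure_eq]
  have hclC : C ⊆ closure (interior C) := by
    rw [hCc.closure_interior_eq_closure_of_nonempty_interior hCi]
    exact subset_closure
  -- By `hint`, `g.symm` takes no point of this connected set to the frontier of `H`. So the set
  -- goes entirely into `interior H` or entirely into `Hᶜ`, and a point of `interior H` near `x₀`
  -- decides which.
  have hN : interior C ∩ ball (G x₀) ρ ⊆ g.symm ⁻¹' interior H := by
    have hpre : IsPreconnected (interior C ∩ ball (G x₀) ρ) :=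
      (hCc.interior.inter (convex_ball _ _)).isPreconnected
    refine hpre.subset_left_of_subset_union (v := g.symm ⁻¹' Hᶜ)
      (isOpen_interior.preimage g.symm.continuous)
      (hHcl.isOpen_compl.preimage g.symm.continuous) ?_ ?_ ?_
    · exact disjoint_left.2 fun w h1 h2 => h2 (interior_subset h1)
    · intro w hw
      by_cases hH : g.symm w ∈ H
      · left
        have h1 : g.symm w ∈ s := ⟨hH, hball hw.2⟩
        rw [mem_preimage, hint _ (hss h1), hg h1, g.apply_symm_apply]
        exact hw.1
      · exact Or.inr hH
    · have h1 : ∀ᶠ x in 𝓝[interior H] x₀, x ∈ ball x₀ r₁ ∧ g x ∈ ball (G x₀) ρ := by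
        refine nhdsWithin_le_nhds (Filter.Eventually.and (ball_mem_nhds _ hr₁)
          (g.continuous.continuousAt.eventually_mem (s := ball (G x₀) ρ) ?_))
        rw [hg hx₀s']
        exact ball_mem_nhds _ hρ
      have : (𝓝[interior H] x₀).NeBot := by
        rw [← mem_closure_iff_nhdsWithin_neBot, hclH]
        exact hx₀
      obtain ⟨x, ⟨hx1, hx2⟩, hx3⟩ := (h1.and eventually_mem_nhdsWithin).exists
      have hxs : x ∈ s := ⟨interior_subset hx3, hx1⟩
      refine ⟨g x, ⟨?_, hx2⟩, ?_⟩
      · rw [← hg hxs]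
        exact (hint x (hss hxs)).1 hx3
      · simpa using hx3
  -- Boundary points of `C` follow by passing to closures.
  have hNC : ∀ w ∈ C ∩ ball (G x₀) ρ, g.symm w ∈ s := by
    intro w hw
    refine ⟨?_, hball hw.2⟩
    have h1 : w ∈ closure (interior C ∩ ball (G x₀) ρ) := by
      rw [inter_comm]
      exact isOpen_ball.inter_closure ⟨hw.2, hclC hw.1⟩
    have h2 : g.symm w ∈ closure (g.symm '' (interior C ∩ ball (G x₀) ρ)) :=
      image_closure_subset_closure_image g.symm.continuous (mem_image_of_mem _ h1)
    rw [← hclH]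
    exact closure_mono (image_subset_iff.2 hN) h2
  refine ⟨ρ, hρ, r₁, ⟨hr₁, hr₁r⟩, g.symm, ?_, fun w hw => ⟨hNC w hw, ?_⟩, fun x hx => ?_⟩
  · refine contDiffOn_of_right_inverse hus ((uniqueDiffOn_convex hCc hCi).inter isOpen_ball) hG
      (fun w hw => hr₁e _ (hNC w hw)) g.symm.continuous.continuousOn
      (fun w hw => hss (hNC w hw)) fun w hw => ?_
    rw [hg (hNC w hw), g.apply_symm_apply]
  · rw [hg (hNC w hw), g.apply_symm_apply]
  · rw [hg hx, g.symm_apply_apply]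

end InverseFunction

/-! ### Fibred coordinates near regular points -/

section FibreCoordinates

variable {E : Type*} [TopologicalSpace E] [ChartedSpace (EuclideanHalfSpace 4) E]

/-- The model space of the total space. -/
abbrev Model := EuclideanSpace ℝ (Fin 4)

theorem IsLefschetzFibration.isInteriorPoint_iff {A : OrientedAtlas E} {π : E → ℂ}
    (hπ : IsLefschetzFibration A π) (y : E) : (𝓡∂ 4).IsInteriorPoint y ↔ ‖π y‖ < 1 := by
  rw [ModelWithCorners.isInteriorPoint_iff_not_isBoundaryPoint, lt_iff_le_and_ne,
    and_iff_right (hπ.mem_disk y), Ne, hπ.boundary y]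
  rfl

variable (E) in
/-- Smooth coordinates `(π, coord)` around a point of the total space of a submersion onto the
closed disk. -/
structure FibreChart (π : E → ℂ) where
  fibreModel : Submodule ℝ Model
  source : Set E
  target : Set (ℂ × fibreModel)
  coord : E → fibreModel
  param : ℂ × fibreModel → E
  isOpen_source : IsOpen source
  isOpen_target : IsOpen target
  coord_smooth : ContMDiffOn (𝓡∂ 4) 𝓘(ℝ, fibreModel) ∞ coord source
  param_smooth : ContMDiffOn 𝓘(ℝ, ℂ × fibreModel) (𝓡∂ 4) ∞ param
    ((closedBall 0 1 ×ˢ univ) ∩ target)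
  proj_param : ∀ w ∈ (closedBall 0 1 ×ˢ univ) ∩ target, π (param w) = w.1
  mem_target : ∀ y ∈ source, (π y, coord y) ∈ (closedBall 0 1 ×ˢ univ) ∩ target
  param_coord : ∀ y ∈ source, param (π y, coord y) = y

/-- A surjective linear map from the model space, together with the projection to its kernel, is
an isomorphism. -/
theorem exists_equiv_prod_ker (f : Model →L[ℝ] ℂ) (hf : Function.Surjective f) :
    ∃ e : Model ≃L[ℝ] ℂ × f.ker,
      (e : Model →L[ℝ] ℂ × f.ker) = f.prod (f.ker.orthogonalProjectionOnto) := by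
  have h2 : f.ker.orthogonalProjectionOnto.range = ⊤ := by
    rw [LinearMap.range_eq_top]
    intro x
    exact ⟨x, Submodule.orthogonalProjectionOnto_mem_subspace_eq_self x⟩
  have hc : IsCompl f.ker f.ker.orthogonalProjectionOnto.ker := by
    rw [Submodule.ker_orthogonalProjectionOnto]
    exact Submodule.isCompl_orthogonal _
  refine ⟨ContinuousLinearMap.equivProdOfSurjectiveOfIsCompl f f.ker.orthogonalProjectionOnto
    (LinearMap.range_eq_top.2 hf) h2 hc, ?_⟩
  ext x <;> rfl

/-- At a regular point, `π` in a chart together with the projection to the kernel of its derivative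
has invertible derivative. Since `∂E = π⁻¹(∂D)`, this map takes interior to interior and boundary to
boundary, so the inverse function theorem above applies at boundary points too. -/
theorem exists_fibreChart [IsManifold (𝓡∂ 4) ∞ E] {A : OrientedAtlas E} {π : E → ℂ}
    (hπ : IsLefschetzFibration A π) {p : E} (hp : ¬ IsCritical π p) :
    ∃ c : FibreChart E π, p ∈ c.source := by
  set ch := extChartAt (𝓡∂ 4) p with hch
  set x₀ : Model := ch p with hx₀
  set H : Set Model := range (𝓡∂ 4) with hH
  have hHeq : H = {y : Model | 0 ≤ y 0} := range_modelWithCornersEuclideanHalfSpace 4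
  have hHc : Convex ℝ H := by
    rw [hHeq]; exact EuclideanHalfSpace.convex
  have hHi : (interior H).Nonempty := by
    rw [hH, interior_range_modelWithCornersEuclideanHalfSpace]
    exact ⟨EuclideanSpace.single 0 1, by simp⟩
  have hx₀H : x₀ ∈ H := mem_range_self _
  obtain ⟨r, hr, hball⟩ : ∃ r > 0, ball x₀ r ∩ H ⊆ ch.target :=
    Metric.mem_nhdsWithin_iff.1 (extChartAt_target_mem_nhdsWithin p)
  have hdiff : MDifferentiableAt (𝓡∂ 4) 𝓘(ℝ, ℂ) π p := hπ.smooth.mdifferentiable (by simp) p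
  set f : Model → ℂ := π ∘ ch.symm with hf
  have hfsm : ContDiffOn ℝ ∞ f ch.target := by
    rw [← contMDiffOn_iff_contDiffOn]
    exact hπ.smooth.comp_contMDiffOn (contMDiffOn_extChartAt_symm p)
  set f' : Model →L[ℝ] ℂ := mfderiv (𝓡∂ 4) 𝓘(ℝ, ℂ) π p with hf'
  have hf'surj : Function.Surjective f' := not_not.1 hp
  have hff' : HasFDerivWithinAt f f' H x₀ := by
    have := hdiff.hasMFDerivAt.2
    simpa [writtenInExtChartAt] using! this
  obtain ⟨e, he⟩ := exists_equiv_prod_ker f' hf'surj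
  set pr : Model →L[ℝ] f'.ker := f'.ker.orthogonalProjectionOnto with hpr
  set G : Model → ℂ × f'.ker := fun x => (f x, pr x) with hG
  set C : Set (ℂ × f'.ker) := closedBall 0 1 ×ˢ univ with hC
  have hCi : interior C = ball 0 1 ×ˢ univ := by
    rw [hC, interior_prod_eq, interior_univ, interior_closedBall _ one_ne_zero]
  have hsymm : ∀ x ∈ H ∩ ball x₀ r, ch.symm x ∈ ch.source ∧ ch (ch.symm x) = x := fun x hx =>
    ⟨ch.map_target (hball ⟨hx.2, hx.1⟩), ch.right_inv (hball ⟨hx.2, hx.1⟩)⟩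
  obtain ⟨ρ, hρ, r', ⟨hr', hr'r⟩, Ψ, hΨ, hΨG, hGΨ⟩ := exists_contDiffOn_local_inverse (C := C)
    (G := G) hHc (𝓡∂ 4).isClosed_range hHi ((convex_closedBall _ _).prod convex_univ)
    (by rw [hCi]; exact ⟨0, by simp⟩) hr hx₀H
    ((hfsm.mono fun x hx => hball ⟨hx.2, hx.1⟩).prodMk pr.contDiff.contDiffOn) e
    (by rw [he]; exact hff'.prodMk pr.hasFDerivWithinAt)
    (by
      intro x hx
      obtain ⟨h1, h2⟩ := hsymm x hx
      rw [hCi]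
      have h3 := hπ.isInteriorPoint_iff (ch.symm x)
      rw [extChartAt_source] at h1
      rw [ModelWithCorners.isInteriorPoint_iff_of_mem_atlas (n := ∞) (by simp)
        (chart_mem_atlas _ p) h1] at h3
      change ch (ch.symm x) ∈ interior ch.target ↔ _ at h3
      rw [h2] at h3
      simp only [hG, mem_prod, mem_ball_zero_iff, mem_univ, and_true, hf, Function.comp_apply,
        ← h3]
      constructor
      · intro hxi
        rw [mem_interior_iff_mem_nhds] at hxi ⊢
        filter_upwards [hxi, isOpen_ball.mem_nhds hx.2] with y hy hy' using hball ⟨hy', hy⟩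
      · exact fun h => OpenPartialHomeomorph.interior_extend_target_subset_interior_range _ h)
  have hsrc : ∀ y ∈ ch.source ∩ ch ⁻¹' ball x₀ r', ch y ∈ H ∩ ball x₀ r' ∧
      G (ch y) = (π y, pr (ch y)) := by
    intro y hy
    refine ⟨⟨mem_range_self _, hy.2⟩, ?_⟩
    simp [hG, hf, ch.left_inv hy.1]
  have hGx₀ : G x₀ = (π p, pr x₀) := by
    change (π (ch.symm (ch p)), pr x₀) = _
    rw [ch.left_inv (mem_extChartAt_source p)]
  refine ⟨
    { fibreModel := f'.ker
      source := (ch.source ∩ ch ⁻¹' ball x₀ r') ∩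
        (ch.source ∩ ch ⁻¹' (pr ⁻¹' ball (pr x₀) ρ)) ∩ π ⁻¹' ball (π p) ρ
      target := ball (G x₀) ρ
      coord := fun y => pr (ch y)
      param := ch.symm ∘ Ψ
      isOpen_source := ?_
      isOpen_target := isOpen_ball
      coord_smooth := ?_
      param_smooth := ?_
      proj_param := ?_
      mem_target := ?_
      param_coord := ?_ }, ?_⟩
  · have hs : ∀ t : Set Model, IsOpen t → IsOpen (ch.source ∩ ch ⁻¹' t) := fun t ht => by
      rw [hch, extChartAt_source]
      exact isOpen_extChartAt_preimage p ht
    exact ((hs _ isOpen_ball).inter (hs _ (isOpen_ball.preimage pr.continuous))).inter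
      (isOpen_ball.preimage hπ.smooth.continuous)
  · refine (pr.contDiff.contMDiff.comp_contMDiffOn (contMDiffOn_extChartAt (x := p))).mono ?_
    intro y hy
    rw [← extChartAt_source (𝓡∂ 4)]
    exact hy.1.1.1
  · refine (contMDiffOn_extChartAt_symm p).comp hΨ.contMDiffOn fun w hw => ?_
    have := (hΨG w hw).1
    exact hball ⟨ball_subset_ball hr'r this.2, this.1⟩
  · exact fun w hw => congrArg Prod.fst (hΨG w hw).2
  · intro y hy
    refine ⟨⟨by simpa using hπ.mem_disk y, mem_univ _⟩, ?_⟩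
    rw [hGx₀, ← ball_prod_same]
    exact ⟨hy.2, hy.1.2.2⟩
  · intro y hy
    obtain ⟨h1, h2⟩ := hsrc y hy.1.1
    simp only [Function.comp_apply]
    rw [← h2, hGΨ _ h1, ch.left_inv hy.1.1.1]
  · exact ⟨⟨⟨mem_extChartAt_source p, mem_ball_self hr'⟩, mem_extChartAt_source p,
      mem_ball_self hρ⟩, mem_ball_self hρ⟩

end FibreCoordinates

/-! ### Homotopies of sections and smoothing over a ball -/

section Smoothing

variable {E : Type*} [TopologicalSpace E]

/-- Two sections over the disk are homotopic through continuous sections. -/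
def SectionHomotopic (π : E → ℂ) (φ ψ : ℂ → E) : Prop :=
  ∃ K : I × ℂ → E, ContinuousOn K (univ ×ˢ closedBall 0 1) ∧
    (∀ t : I, ∀ z ∈ closedBall (0 : ℂ) 1, π (K (t, z)) = z) ∧
    (∀ z ∈ closedBall (0 : ℂ) 1, K (0, z) = φ z) ∧
    (∀ z ∈ closedBall (0 : ℂ) 1, K (1, z) = ψ z)

theorem SectionHomotopic.refl {π : E → ℂ} {φ : ℂ → E} (h : IsContinuousSection π φ) :
    SectionHomotopic π φ φ :=
  ⟨fun p => φ p.2, h.1.comp continuousOn_snd fun _ hp => hp.2, fun _ => h.2,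
    fun _ _ => rfl, fun _ _ => rfl⟩

theorem SectionHomotopic.trans {π : E → ℂ} {φ ψ χ : ℂ → E} (h : SectionHomotopic π φ ψ)
    (h' : SectionHomotopic π ψ χ) : SectionHomotopic π φ χ := by
  obtain ⟨K, hK, hKs, hK0, hK1⟩ := h
  obtain ⟨L, hL, hLs, hL0, hL1⟩ := h'
  let a : I → I := fun t => projIcc 0 1 zero_le_one (2 * (t : ℝ))
  let b : I → I := fun t => projIcc 0 1 zero_le_one (2 * (t : ℝ) - 1)
  have ha : Continuous a := continuous_projIcc.comp (by fun_prop)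
  have hb : Continuous b := continuous_projIcc.comp (by fun_prop)
  let M : I × ℂ → E := fun p => if (p.1 : ℝ) ≤ 1 / 2 then K (a p.1, p.2) else L (b p.1, p.2)
  have hM1 : ∀ p : I × ℂ, (p.1 : ℝ) ≤ 1 / 2 → M p = K (a p.1, p.2) := fun p hp => if_pos hp
  have hM2 : ∀ p : I × ℂ, 1 / 2 ≤ (p.1 : ℝ) → p.2 ∈ closedBall (0 : ℂ) 1 →
      M p = L (b p.1, p.2) := by
    intro p hp hz
    rcases hp.eq_or_lt with h | h
    · have h1 : a p.1 = 1 := projIcc_of_right_le _ (by linarith)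
      have h2 : b p.1 = 0 := projIcc_of_le_left _ (by linarith)
      rw [hM1 p h.ge, h1, h2, hK1 _ hz, hL0 _ hz]
    · exact if_neg (not_le.2 h)
  refine ⟨M, ?_, fun t z hz => ?_, fun z hz => ?_, fun z hz => ?_⟩
  · have hcl1 : IsClosed {p : I × ℂ | (p.1 : ℝ) ≤ 1 / 2} :=
      isClosed_le (by fun_prop) continuous_const
    have hcl2 : IsClosed {p : I × ℂ | 1 / 2 ≤ (p.1 : ℝ)} :=
      isClosed_le continuous_const (by fun_prop)
    have hD : IsClosed ((univ : Set I) ×ˢ closedBall (0 : ℂ) 1) :=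
      isClosed_univ.prod isClosed_closedBall
    have h1 : ContinuousOn M ({p : I × ℂ | (p.1 : ℝ) ≤ 1 / 2} ∩ univ ×ˢ closedBall 0 1) := by
      refine ContinuousOn.congr (f := fun p : I × ℂ => K (a p.1, p.2)) ?_ fun p hp => hM1 p hp.1
      exact hK.comp (by fun_prop) fun p hp => ⟨mem_univ _, hp.2.2⟩
    have h2 : ContinuousOn M ({p : I × ℂ | 1 / 2 ≤ (p.1 : ℝ)} ∩ univ ×ˢ closedBall 0 1) := by
      refine ContinuousOn.congr (f := fun p : I × ℂ => L (b p.1, p.2)) ?_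
        fun p hp => hM2 p hp.1 hp.2.2
      exact hL.comp (by fun_prop) fun p hp => ⟨mem_univ _, hp.2.2⟩
    refine (h1.union_of_isClosed h2 (hcl1.inter hD) (hcl2.inter hD)).mono fun p hp => ?_
    rcases le_total (p.1 : ℝ) (1 / 2) with h | h
    · exact Or.inl ⟨h, hp⟩
    · exact Or.inr ⟨h, hp⟩
  · rcases le_total (t : ℝ) (1 / 2) with h | h
    · rw [hM1 _ h]; exact hKs _ _ hz
    · rw [hM2 _ h hz]; exact hLs _ _ hz
  · have h1 : a 0 = 0 := projIcc_of_le_left _ (by simp)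
    rw [hM1 (0, z) (by simp), h1, hK0 _ hz]
  · have h1 : b 1 = 1 := projIcc_of_right_le _ (by norm_num)
    rw [hM2 (1, z) (by norm_num) hz, h1, hL1 _ hz]

variable [ChartedSpace (EuclideanHalfSpace 4) E]

/-- `φ` is locally the restriction of a smooth map at the points of `T`. -/
def HasSmoothGerms (T : Set ℂ) (φ : ℂ → E) : Prop :=
  ∀ z ∈ T, ∃ U ∈ 𝓝 z, ∃ s : ℂ → E, ContMDiffOn 𝓘(ℝ, ℂ) (𝓡∂ 4) ∞ s U ∧ ∀ y ∈ U ∩ T, s y = φ y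

/-- A continuous function on a compact set can be approximated by a smooth function that agrees
with it on a closed set where it has smooth local extensions. -/
theorem exists_smooth_approx {F : Type*} [NormedAddCommGroup F] [NormedSpace ℝ F]
    {K T : Set ℂ} (hK : IsClosed K) (hT : IsClosed T) {f : ℂ → F} (hf : ContinuousOn f K)
    (hfT : ∀ z ∈ T ∩ K, ∃ U ∈ 𝓝 z, ∃ g : ℂ → F, ContDiffOn ℝ ∞ g U ∧ ∀ y ∈ U ∩ T ∩ K, g y = f y)
    {ε : ℝ} (hε : 0 < ε) :
    ∃ h : ℂ → F, ContDiff ℝ ∞ h ∧ (∀ z ∈ K, dist (h z) (f z) < ε) ∧ ∀ z ∈ K ∩ T, h z = f z := by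
  -- Local solutions are glued by a partition of unity. This is possible because the values allowed
  -- at `z` form a convex set: a ball around `f z`, cut down to `f z` itself on `T`, and everything
  -- off `K`.
  obtain ⟨h, hh⟩ := exists_contMDiffMap_forall_mem_convex_of_local 𝓘(ℝ, ℂ)
    (n := ⊤) (F := F) (t := fun z => {v | z ∈ K → v ∈ ball (f z) ε ∧ (z ∈ T → v = f z)})
    (by
      intro z
      by_cases hz : z ∈ K <;> by_cases hzT : z ∈ T
      · have : {v | z ∈ K → v ∈ ball (f z) ε ∧ (z ∈ T → v = f z)} = ball (f z) ε ∩ {f z} := by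
          ext v; simp [hz, hzT]
        rw [this]
        exact (convex_ball _ _).inter (convex_singleton _)
      · have : {v | z ∈ K → v ∈ ball (f z) ε ∧ (z ∈ T → v = f z)} = ball (f z) ε := by
          ext v; simp [hz, hzT]
        rw [this]
        exact convex_ball _ _
      · simp [hz, convex_univ]
      · simp [hz, convex_univ])
    (by
      intro z
      by_cases hz : z ∈ K
      swap
      · exact ⟨Kᶜ, hK.isOpen_compl.mem_nhds hz, fun _ => 0, contMDiffOn_const,
          fun y hy hy' => absurd hy' hy⟩
      have hfz : ∀ᶠ y in 𝓝 z, y ∈ K → dist (f y) (f z) < ε / 2 := by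
        rw [← eventually_nhdsWithin_iff]
        exact (hf z hz).eventually (ball_mem_nhds _ (half_pos hε))
      by_cases hzT : z ∈ T
      · obtain ⟨U, hU, g, hg, hgf⟩ := hfT z ⟨hzT, hz⟩
        have hgc : ∀ᶠ y in 𝓝 z, dist (g y) (g z) < ε / 2 :=
          (hg.continuousOn.continuousAt hU).eventually (ball_mem_nhds _ (half_pos hε))
        have hgz : g z = f z := hgf z ⟨⟨mem_of_mem_nhds hU, hzT⟩, hz⟩
        refine ⟨{y | (y ∈ U ∧ (y ∈ K → dist (f y) (f z) < ε / 2)) ∧ dist (g y) (g z) < ε / 2},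
          (Filter.Eventually.and (Filter.Eventually.and hU hfz) hgc), g, ?_, ?_⟩
        · exact (hg.mono fun y hy => hy.1.1).contMDiffOn
        · intro y hy hyK
          refine ⟨?_, fun hyT => hgf y ⟨⟨hy.1.1, hyT⟩, hyK⟩⟩
          have h1 := hy.1.2 hyK
          have h2 := hy.2
          rw [hgz] at h2
          rw [mem_ball]
          have := dist_triangle_right (g y) (f y) (f z)
          linarith
      · refine ⟨{y | (y ∈ K → dist (f y) (f z) < ε / 2) ∧ y ∈ Tᶜ},
          Filter.Eventually.and hfz (hT.isOpen_compl.mem_nhds hzT), fun _ => f z,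
          contMDiffOn_const, ?_⟩
        intro y hy hyK
        refine ⟨?_, fun h => absurd h hy.2⟩
        rw [mem_ball, dist_comm]
        have := hy.1 hyK
        linarith)
  exact ⟨h, h.contMDiff.contDiff, fun z hz => (hh z hz).1, fun z hz => (hh z hz.1).2 hz.2⟩

/-- Smoothing of a section over a small ball. -/
theorem exists_smooth_on_ball {π : E → ℂ} (c : FibreChart E π) {φ : ℂ → E}
    (hφ : IsContinuousSection π φ) {T : Set ℂ} (hT : IsClosed T)
    (hTφ : HasSmoothGerms T φ) (hTD : T ⊆ closedBall 0 1) {O : Set (ℂ × E)} (hO : IsOpen O)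
    (hφO : ∀ z ∈ closedBall (0 : ℂ) 1, (z, φ z) ∈ O) {z₀ : ℂ} {δ : ℝ} (hδ : 0 < δ)
    (hmaps : MapsTo φ (closedBall z₀ (2 * δ) ∩ closedBall 0 1) c.source) :
    ∃ ψ : ℂ → E, IsContinuousSection π ψ ∧ SectionHomotopic π φ ψ ∧ EqOn ψ φ T ∧
      (∀ z ∈ closedBall (0 : ℂ) 1, (z, ψ z) ∈ O) ∧
      (∀ z ∈ closedBall (0 : ℂ) 1,
        ContMDiffWithinAt 𝓘(ℝ, ℂ) (𝓡∂ 4) ∞ φ (closedBall 0 1) z →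
        ContMDiffWithinAt 𝓘(ℝ, ℂ) (𝓡∂ 4) ∞ ψ (closedBall 0 1) z) ∧
      (∀ z ∈ closedBall (0 : ℂ) 1, z ∈ ball z₀ δ →
        ContMDiffWithinAt 𝓘(ℝ, ℂ) (𝓡∂ 4) ∞ ψ (closedBall 0 1) z) := by
  set D : Set ℂ := closedBall 0 1 with hD
  set B : Set ℂ := ball z₀ (2 * δ) with hB
  set K : Set ℂ := closedBall z₀ (2 * δ) ∩ D with hKdef
  set f : ℂ → c.fibreModel := fun z => c.coord (φ z) with hf
  have hBK : ∀ z ∈ B, z ∈ D → z ∈ K := fun z hz hzD => ⟨ball_subset_closedBall hz, hzD⟩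
  have hKc : IsCompact K := (isCompact_closedBall _ _).inter_right isClosed_closedBall
  have hfc : ContinuousOn f K := c.coord_smooth.continuousOn.comp (hφ.1.mono inter_subset_right)
    hmaps
  have hparam : ∀ z ∈ K, c.param (z, f z) = φ z := by
    intro z hz
    have := c.param_coord (φ z) (hmaps hz)
    rwa [hφ.2 z hz.2] at this
  -- the size of the perturbation
  obtain ⟨V, hV, hVN⟩ : ∃ V : Set (ℂ × c.fibreModel), IsOpen V ∧
      {w ∈ (D ×ˢ univ) ∩ c.target | (w.1, c.param w) ∈ O} = (D ×ˢ univ) ∩ V := by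
    have h1 : ContinuousOn (fun w : ℂ × c.fibreModel => (w.1, c.param w))
        ((D ×ˢ univ) ∩ c.target) := continuousOn_fst.prodMk c.param_smooth.continuousOn
    obtain ⟨u, hu, hu'⟩ := continuousOn_iff'.1 h1 O hO
    refine ⟨u ∩ c.target, hu.inter c.isOpen_target, ?_⟩
    ext w
    have := Set.ext_iff.1 hu' w
    simp only [mem_inter_iff, mem_preimage, mem_ofPred_eq] at this ⊢
    tauto
  have hgraph : (fun z => (z, f z)) '' K ⊆ V := by
    rintro _ ⟨z, hz, rfl⟩
    have h1 := c.mem_target (φ z) (hmaps hz)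
    rw [hφ.2 z hz.2] at h1
    have : (z, f z) ∈ {w ∈ (D ×ˢ univ) ∩ c.target | (w.1, c.param w) ∈ O} := by
      refine ⟨h1, ?_⟩
      rw [hparam z hz]
      exact hφO z hz.2
    rw [hVN] at this
    exact this.2
  obtain ⟨ε, hε, hthick⟩ := (hKc.image_of_continuousOn
    (continuousOn_id.prodMk hfc)).exists_thickening_subset_open hV hgraph
  have hclose : ∀ z ∈ K, ∀ q, dist q (f z) < ε →
      (z, q) ∈ (D ×ˢ univ) ∩ c.target ∧ (z, c.param (z, q)) ∈ O := by
    intro z hz q hq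
    have h1 : (z, q) ∈ {w ∈ (D ×ˢ univ) ∩ c.target | (w.1, c.param w) ∈ O} := by
      rw [hVN]
      refine ⟨⟨hz.2, mem_univ _⟩, hthick ?_⟩
      rw [mem_thickening_iff]
      refine ⟨_, mem_image_of_mem _ hz, ?_⟩
      simpa [Prod.dist_eq, hε] using hq
    exact h1
  -- the smooth approximation
  obtain ⟨h, hh, hhf, hhT⟩ := exists_smooth_approx (K := K) (T := T) (f := f)
    hKc.isClosed hT hfc (by
      rintro z ⟨hzT, hzK⟩
      obtain ⟨U, hU, s, hs, hsφ⟩ := hTφ z hzT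
      have hsz : s z = φ z := hsφ z ⟨mem_of_mem_nhds hU, hzT⟩
      have hpre : s ⁻¹' c.source ∈ 𝓝 z := by
        apply (hs.continuousOn.continuousAt hU).preimage_mem_nhds
        rw [hsz]
        exact c.isOpen_source.mem_nhds (hmaps hzK)
      refine ⟨U ∩ s ⁻¹' c.source, inter_mem hU hpre, fun y => c.coord (s y), ?_, ?_⟩
      · rw [← contMDiffOn_iff_contDiffOn]
        exact c.coord_smooth.comp (hs.mono inter_subset_left) fun y hy => hy.2
      · intro y hy
        simp only [hf]
        rw [hsφ y ⟨hy.1.1.1, hy.1.2⟩]) hε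
  -- The section is moved linearly in the fibre coordinate from `f` to `f + χ (h - f)`, which leaves
  -- `π` unchanged. On the `δ`-ball the result is `h`; the support radius below `2 * δ` leaves a
  -- collar on which it is still `φ`.
  let χ : ContDiffBump z₀ := ⟨δ, 3 / 2 * δ, hδ, by linarith⟩
  have hχsupp : ∀ z, z ∉ closedBall z₀ (3 / 2 * δ) → ∀ᶠ y in 𝓝 z, χ y = 0 := by
    intro z hz
    have : z ∉ tsupport χ := by rw [χ.tsupport_eq]; exact hz
    exact notMem_tsupport_iff_eventuallyEq.1 this
  let g : ℝ → ℂ → c.fibreModel := fun t z => f z + (t * χ z) • (h z - f z)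
  have hg : ∀ t : I, ∀ z ∈ K, dist (g t z) (f z) < ε := by
    intro t z hz
    have h1 := hhf z hz
    rw [dist_eq_norm] at h1 ⊢
    simp only [g, add_sub_cancel_left]
    rw [norm_smul]
    have h2 : ‖(t : ℝ) * χ z‖ ≤ 1 := by
      rw [Real.norm_of_nonneg (mul_nonneg t.2.1 χ.nonneg)]
      exact mul_le_one₀ t.2.2 χ.nonneg χ.le_one
    calc _ ≤ 1 * ‖h z - f z‖ := by gcongr
      _ < ε := by rwa [one_mul]
  classical
  let Φ : I × ℂ → E := fun p => if p.2 ∈ B then c.param (p.2, g p.1 p.2) else φ p.2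
  have hΦB : ∀ t : I, ∀ z ∈ B, Φ (t, z) = c.param (z, g t z) := fun t z hz => if_pos hz
  have hΦeq : ∀ t : I, ∀ z ∈ D, χ z = 0 → Φ (t, z) = φ z := by
    intro t z hz hχ
    by_cases hzB : z ∈ B
    · rw [hΦB t z hzB]
      simp only [g, hχ, mul_zero, zero_smul, add_zero]
      exact hparam z (hBK z hzB hz)
    · exact if_neg hzB
  have hcases : ∀ z : ℂ, z ∈ B ∨ z ∉ closedBall z₀ (3 / 2 * δ) := by
    intro z
    by_cases hz : z ∈ B
    · exact Or.inl hz
    · refine Or.inr fun h => hz ?_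
      rw [hB, mem_ball]
      rw [mem_closedBall] at h
      linarith
  have hχ0 : ∀ z, z ∉ B → χ z = 0 := fun z hz =>
    (hχsupp z ((hcases z).resolve_left hz)).self_of_nhds
  have hΦs : ∀ t : I, ∀ z ∈ D, π (Φ (t, z)) = z := by
    intro t z hz
    by_cases hzB : z ∈ B
    · rw [hΦB t z hzB]
      exact c.proj_param _ (hclose z (hBK z hzB hz) _ (hg t z (hBK z hzB hz))).1
    · rw [hΦeq t z hz (hχ0 z hzB)]
      exact hφ.2 z hz
  have hΦc : ContinuousOn Φ (univ ×ˢ D) := by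
    rintro ⟨t, z⟩ ⟨-, hz⟩
    rcases hcases z with hzB | hzB
    · have hnhds : univ ×ˢ B ∈ 𝓝 (t, z) := (isOpen_univ.prod isOpen_ball).mem_nhds ⟨mem_univ _, hzB⟩
      rw [← continuousWithinAt_inter hnhds]
      have h1 : ContinuousOn (fun p : I × ℂ => c.param (p.2, g p.1 p.2))
          (univ ×ˢ D ∩ univ ×ˢ B) := by
        refine c.param_smooth.continuousOn.comp ?_ fun p hp =>
          (hclose p.2 (hBK _ hp.2.2 hp.1.2) _ (hg p.1 p.2 (hBK _ hp.2.2 hp.1.2))).1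
        have h2 : ContinuousOn (fun p : I × ℂ => f p.2) (univ ×ˢ D ∩ univ ×ˢ B) :=
          hfc.comp continuousOn_snd fun p hp => hBK _ hp.2.2 hp.1.2
        have h3 : Continuous (fun p : I × ℂ => h p.2) := hh.continuous.comp continuous_snd
        have h4 : Continuous (fun p : I × ℂ => (p.1 : ℝ) * χ p.2) :=
          (continuous_subtype_val.comp continuous_fst).mul (χ.continuous.comp continuous_snd)
        exact continuousOn_snd.prodMk (h2.add (h4.continuousOn.smul (h3.continuousOn.sub h2)))
      exact (h1.congr fun p hp => hΦB p.1 p.2 hp.2.2) _ ⟨⟨mem_univ _, hz⟩, ⟨mem_univ _, hzB⟩⟩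
    · have h1 : ContinuousWithinAt (fun p : I × ℂ => φ p.2) (univ ×ˢ D) (t, z) :=
        (hφ.1.comp continuousOn_snd fun _ hp => hp.2) (t, z) ⟨mem_univ _, hz⟩
      refine h1.congr_of_eventuallyEq_of_mem ?_ ⟨mem_univ _, hz⟩
      have h2 : ∀ᶠ p : I × ℂ in 𝓝 (t, z), χ p.2 = 0 :=
        (continuous_snd.tendsto (t, z)).eventually (hχsupp z hzB)
      filter_upwards [nhdsWithin_le_nhds h2, self_mem_nhdsWithin] with p hp hp'
      exact hΦeq p.1 p.2 hp'.2 hp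
  have hψ : IsContinuousSection π fun z => Φ (1, z) :=
    ⟨hΦc.comp (by fun_prop) fun z hz => ⟨mem_univ _, hz⟩, hΦs 1⟩
  have hsm : ∀ z ∈ D, z ∈ B → ContDiffWithinAt ℝ ∞ (g 1) D z →
      ContMDiffWithinAt 𝓘(ℝ, ℂ) (𝓡∂ 4) ∞ (fun z => Φ (1, z)) D z := by
    intro z hz hzB hgz
    have hmem : ∀ y ∈ D ∩ B, (y, g 1 y) ∈ (D ×ˢ univ) ∩ c.target := fun y hy =>
      (hclose y (hBK _ hy.2 hy.1) _ (by simpa using hg 1 y (hBK _ hy.2 hy.1))).1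
    have hnB : B ∈ 𝓝 z := isOpen_ball.mem_nhds hzB
    rw [← contMDiffWithinAt_inter hnB]
    have h1 : ContMDiffWithinAt 𝓘(ℝ, ℂ) 𝓘(ℝ, ℂ × c.fibreModel) ∞ (fun y => (y, g 1 y))
        (D ∩ B) z :=
      ((contDiffWithinAt_id.prodMk hgz).contMDiffWithinAt).mono inter_subset_left
    have h2 := (c.param_smooth _ (hmem z ⟨hz, hzB⟩)).comp z h1 hmem
    refine h2.congr_of_eventuallyEq_of_mem ?_ ⟨hz, hzB⟩
    filter_upwards [self_mem_nhdsWithin] with y hy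
    simpa using! hΦB 1 y hy.2
  refine ⟨fun z => Φ (1, z), hψ, ⟨Φ, hΦc, hΦs, fun z hz => ?_, fun _ _ => rfl⟩, fun z hz => ?_,
    fun z hz => ?_, fun z hz hzs => ?_, fun z hz hzδ => ?_⟩
  · by_cases hzB : z ∈ B
    · rw [hΦB 0 z hzB]
      simp only [g, Icc.coe_zero, zero_mul, zero_smul, add_zero]
      exact hparam z (hBK z hzB hz)
    · exact hΦeq 0 z hz (hχ0 z hzB)
  · by_cases hzB : z ∈ B
    · have hzK := hBK z hzB (hTD hz)
      simp only [hΦB 1 z hzB, g, hhT z ⟨hzK, hz⟩, sub_self, smul_zero, add_zero]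
      exact hparam z hzK
    · exact hΦeq 1 z (hTD hz) (hχ0 z hzB)
  · by_cases hzB : z ∈ B
    · have hzK := hBK z hzB hz
      simp only [hΦB 1 z hzB]
      exact (hclose z hzK _ (hg 1 z hzK)).2
    · simp only [hΦeq 1 z hz (hχ0 z hzB)]
      exact hφO z hz
  · rcases hcases z with hzB | hzB
    · refine hsm z hz hzB ?_
      have hfz : ContDiffWithinAt ℝ ∞ f D z := by
        rw [← contMDiffWithinAt_iff_contDiffWithinAt]
        exact (c.coord_smooth.contMDiffAt (c.isOpen_source.mem_nhds
          (hmaps (hBK z hzB hz)))).comp_contMDiffWithinAt z hzs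
      exact hfz.add ((contDiffWithinAt_const.mul χ.contDiff.contDiffWithinAt).smul
        (hh.contDiffWithinAt.sub hfz))
    · refine hzs.congr_of_eventuallyEq_of_mem ?_ hz
      filter_upwards [nhdsWithin_le_nhds (hχsupp z hzB), self_mem_nhdsWithin] with y hy hy'
      exact hΦeq 1 y hy' hy
  · refine hsm z hz (ball_subset_ball (by linarith) hzδ) ?_
    refine hh.contDiffWithinAt.congr_of_eventuallyEq_of_mem ?_ hz
    filter_upwards [nhdsWithin_le_nhds (isOpen_ball.mem_nhds hzδ)] with y hy
    have : χ y = 1 := χ.one_of_mem_closedBall (ball_subset_closedBall hy)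
    simp [g, this]

end Smoothing

/-! ### Smoothing away from the critical points, relative to the boundary -/

section SmoothSections

variable {E : Type*} [TopologicalSpace E] [ChartedSpace (EuclideanHalfSpace 4) E]

theorem HasSmoothGerms.congr {T : Set ℂ} {φ ψ : ℂ → E} (h : HasSmoothGerms T φ)
    (hψ : EqOn ψ φ T) : HasSmoothGerms T ψ := by
  intro z hz
  obtain ⟨U, hU, s, hs, hsφ⟩ := h z hz
  exact ⟨U, hU, s, hs, fun y hy => (hsφ y hy).trans (hψ hy.2).symm⟩

/-- A continuous section that avoids the critical points is homotopic to a smooth section,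
relative to a closed set where it has smooth local extensions. -/
theorem exists_isSmoothSection [IsManifold (𝓡∂ 4) ∞ E] {A : OrientedAtlas E} {π : E → ℂ}
    (hπ : IsLefschetzFibration A π) {φ : ℂ → E} (hφ : IsContinuousSection π φ)
    (hcrit : ∀ z ∈ closedBall (0 : ℂ) 1, ¬ IsCritical π (φ z)) {T : Set ℂ} (hT : IsClosed T)
    (hTφ : HasSmoothGerms T φ) (hTD : T ⊆ closedBall 0 1) :
    ∃ ψ : ℂ → E, IsSmoothSection π ψ ∧ SectionHomotopic π φ ψ ∧ EqOn ψ φ T := by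
  have hloc : ∀ z : closedBall (0 : ℂ) 1, ∃ c : FibreChart E π, ∃ δ > 0,
      MapsTo φ (closedBall (z : ℂ) (2 * δ) ∩ closedBall 0 1) c.source := by
    intro z
    obtain ⟨c, hc⟩ := exists_fibreChart hπ (hcrit z z.2)
    have h1 : φ ⁻¹' c.source ∈ 𝓝[closedBall 0 1] (z : ℂ) :=
      (hφ.1 z z.2).preimage_mem_nhdsWithin (c.isOpen_source.mem_nhds hc)
    obtain ⟨r, hr, hball⟩ := Metric.mem_nhdsWithin_iff.1 h1
    refine ⟨c, r / 4, by positivity, fun y hy => hball ⟨?_, hy.2⟩⟩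
    have := mem_closedBall.1 hy.1
    rw [mem_ball]
    linarith
  choose c δ hδ hmaps using hloc
  obtain ⟨t, ht⟩ := (isCompact_closedBall (0 : ℂ) 1).elim_nhds_subcover'
    (fun z hz => ball z (δ ⟨z, hz⟩)) fun z hz => ball_mem_nhds _ (hδ ⟨z, hz⟩)
  -- An open condition: over the `i`-th closed ball the section stays in the `i`-th chart. Every
  -- correction preserves it, so charts chosen for `φ` remain usable for all later sections.
  set O : Set (ℂ × E) := {p | ∀ i ∈ t, p.1 ∈ closedBall (i : ℂ) (2 * δ i) → p.2 ∈ (c i).source}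
    with hOdef
  have hO : IsOpen O := by
    have : O = ⋂ i ∈ t, ((Prod.fst ⁻¹' (closedBall (i : ℂ) (2 * δ i))ᶜ) ∪
        Prod.snd ⁻¹' (c i).source) := by
      ext p
      simp [hOdef, imp_iff_not_or]
    rw [this]
    refine isOpen_biInter_finset fun i _ => ?_
    exact (isClosed_closedBall.isOpen_compl.preimage continuous_fst).union
      ((c i).isOpen_source.preimage continuous_snd)
  have key : ∀ t' ⊆ t, ∃ ψ : ℂ → E, IsContinuousSection π ψ ∧ SectionHomotopic π φ ψ ∧ EqOn ψ φ T ∧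
      (∀ z ∈ closedBall (0 : ℂ) 1, (z, ψ z) ∈ O) ∧
      ∀ z ∈ closedBall (0 : ℂ) 1, ∀ i ∈ t', z ∈ ball (i : ℂ) (δ i) →
        ContMDiffWithinAt 𝓘(ℝ, ℂ) (𝓡∂ 4) ∞ ψ (closedBall 0 1) z := by
    classical
    intro t'
    induction t' using Finset.induction_on with
    | empty =>
      intro _
      exact ⟨φ, hφ, .refl hφ, fun _ _ => rfl, fun z hz i _ hzi => hmaps i ⟨hzi, hz⟩, by simp⟩
    | insert i t' _ ih =>
      intro hsub
      obtain ⟨ψ, h1, h2, h3, h4, h5⟩ := ih ((Finset.subset_insert _ _).trans hsub)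
      obtain ⟨ψ', h1', h2', h3', h4', h5', h6'⟩ := exists_smooth_on_ball (c i) h1 hT
        (hTφ.congr h3) hTD hO h4 (hδ i)
        (fun z hz => h4 z hz.2 i (hsub (Finset.mem_insert_self _ _)) hz.1)
      refine ⟨ψ', h1', h2.trans h2', h3'.trans h3, h4', fun z hz j hj hzj => ?_⟩
      rcases Finset.mem_insert.1 hj with rfl | hj
      · exact h6' z hz hzj
      · exact h5' z hz (h5 z hz j hj hzj)
  obtain ⟨ψ, h1, h2, h3, -, h5⟩ := key t subset_rfl
  refine ⟨ψ, ⟨fun z hz => ?_, h1.2⟩, h2, h3⟩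
  obtain ⟨i, hi, hzi⟩ := mem_iUnion₂.1 (ht hz)
  exact h5 z hz i hi hzi

/-- A map that restricts to a smooth map on the unit circle has smooth local extensions there. -/
theorem hasSmoothGerms_sphere {φ : ℂ → E} {s : Circle → E} (hs : ContMDiff (𝓡 1) (𝓡∂ 4) ∞ s)
    (hφs : Extends φ s) : HasSmoothGerms (sphere 0 1) φ := by
  intro z hz
  let c : Circle := ⟨z, by simpa [Submonoid.unitSphere] using hz⟩
  have hc : (c : ℂ) = z := rfl
  have hz0 : z ≠ 0 := by
    rintro rfl
    simp at hz
  -- The extension is constant along rays; measuring the argument relative to `z` keeps the branch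
  -- cut away from `z`.
  refine ⟨{y | y / z ∈ Complex.slitPlane}, ?_, fun y => s (c * Circle.exp (y / z).arg), ?_, ?_⟩
  · refine (Complex.isOpen_slitPlane.preimage (continuous_id.div_const z)).mem_nhds ?_
    simp [hz0]
  · refine hs.comp_contMDiffOn ?_
    refine contMDiffOn_const.mul (contMDiff_circleExp.comp_contMDiffOn ?_)
    rw [contMDiffOn_iff_contDiffOn]
    intro y hy
    have h1 : ContDiffAt ℝ ∞ (fun y : ℂ => Complex.log (y / z)) y := by
      have h0 : ContDiffAt ℝ ∞ (fun y : ℂ => y / z) y := contDiffAt_id.div_const z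
      have h0' : ContDiffAt ℝ ∞ Complex.log (y / z) :=
        (Complex.contDiffAt_log hy).restrict_scalars ℝ
      exact h0'.comp y h0
    have h2 : ContDiffAt ℝ ∞ (fun y : ℂ => Complex.imCLM (Complex.log (y / z))) y :=
      Complex.imCLM.contDiff.contDiffAt.comp y h1
    simpa [Complex.log_im] using! h2.contDiffWithinAt
  · rintro y ⟨-, hy⟩
    let d : Circle := ⟨y, by simpa [Submonoid.unitSphere] using hy⟩
    have h1 : c * Circle.exp (y / z).arg = d := by
      have : y / z = ((d / c : Circle) : ℂ) := (Circle.coe_div d c).symm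
      rw [this, Circle.exp_arg, mul_div_cancel]
    change s (c * Circle.exp (y / z).arg) = φ y
    rw [h1]
    exact (hφs d).symm

/-- A smooth section passes through no critical point. -/
theorem IsSmoothSection.not_isCritical [IsManifold (𝓡∂ 4) ∞ E] {A : OrientedAtlas E} {π : E → ℂ}
    (hπ : IsLefschetzFibration A π) {φ : ℂ → E} (hφ : IsSmoothSection π φ)
    {z : ℂ} (hz : z ∈ closedBall (0 : ℂ) 1) : ¬ IsCritical π (φ z) := by
  intro hc
  have h1 : ‖z‖ < 1 := by
    have := (hπ.isInteriorPoint_iff _).1 (hπ.critical_interior _ hc)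
    rwa [hφ.2 z hz] at this
  have hnhds : closedBall (0 : ℂ) 1 ∈ 𝓝 z := by
    refine mem_of_superset (isOpen_ball.mem_nhds ?_) ball_subset_closedBall
    simpa using h1
  have h2 : MDifferentiableAt 𝓘(ℝ, ℂ) (𝓡∂ 4) φ z :=
    (hφ.1.contMDiffAt hnhds).mdifferentiableAt (by simp)
  have h3 : MDifferentiableAt (𝓡∂ 4) 𝓘(ℝ, ℂ) π (φ z) := hπ.smooth.mdifferentiable (by simp) _
  -- The derivative of `π ∘ φ = id` is computed in two ways, which exhibits a right inverse of the
  -- derivative of `π`.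
  have h4 : HasMFDerivAt 𝓘(ℝ, ℂ) 𝓘(ℝ, ℂ) (π ∘ φ) z
      ((mfderiv (𝓡∂ 4) 𝓘(ℝ, ℂ) π (φ z)).comp (mfderiv 𝓘(ℝ, ℂ) (𝓡∂ 4) φ z)) :=
    h3.hasMFDerivAt.comp z h2.hasMFDerivAt
  have h5 : HasMFDerivAt 𝓘(ℝ, ℂ) 𝓘(ℝ, ℂ) (π ∘ φ) z
      (ContinuousLinearMap.id ℝ (TangentSpace 𝓘(ℝ, ℂ) z)) := by
    refine (hasMFDerivAt_id z).congr_of_eventuallyEq ?_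
    filter_upwards [hnhds] with y hy using hφ.2 y hy
  have h6 := hasMFDerivAt_unique h4 h5
  refine hc fun v => ⟨mfderiv 𝓘(ℝ, ℂ) (𝓡∂ 4) φ z v, ?_⟩
  exact DFunLike.congr_fun h6 v

end SmoothSections

/-! ### Continuity of unique solutions, and homotopies from squares -/

section Tools

/-- An equation `P (x, y) = Q x` that has a unique solution `y` in a compact space for every `x`
is solved by a continuous function. -/
theorem exists_continuous_solution {X Y Z : Type*} [TopologicalSpace X] [TopologicalSpace Y]
    [CompactSpace Y] [TopologicalSpace Z] [T2Space Z] {P : X × Y → Z} {Q : X → Z}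
    (hP : Continuous P) (hQ : Continuous Q) (h : ∀ x, ∃! y, P (x, y) = Q x) :
    ∃ f : C(X, Y), ∀ x y, P (x, y) = Q x ↔ y = f x := by
  choose f hf huniq using h
  have hiff : ∀ x y, P (x, y) = Q x ↔ y = f x := fun x y =>
    ⟨huniq x y, fun hy => hy ▸ hf x⟩
  refine ⟨⟨f, ?_⟩, hiff⟩
  rw [continuous_iff_isClosed]
  intro C hC
  -- Closed graph argument: the preimage of a closed set is the projection of a closed set along the
  -- compact factor `Y`.
  have : f ⁻¹' C = Prod.fst '' ({p : X × Y | P p = Q p.1} ∩ Prod.snd ⁻¹' C) := by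
    ext x
    constructor
    · exact fun hx => ⟨(x, f x), ⟨hf x, hx⟩, rfl⟩
    · rintro ⟨⟨x', y⟩, ⟨h1, h2⟩, rfl⟩
      rw [mem_preimage, ← (hiff x' y).1 h1]
      exact h2
  rw [this]
  exact isClosedMap_fst_of_compactSpace _
    ((isClosed_eq hP (hQ.comp continuous_fst)).inter (hC.preimage continuous_snd))

variable {S : Type*} [TopologicalSpace S]

/-- Paths that factor through paths of a simply connected space are homotopic. -/
theorem homotopic_of_factor {Z : Type*} [TopologicalSpace Z] [SimplyConnectedSpace Z]
    {f : Z → S} (hf : Continuous f) {x y : S} {p q : Path x y} {u v : Z} (P Q : Path u v)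
    (hp : ∀ t, p t = f (P t)) (hq : ∀ t, q t = f (Q t)) : p.Homotopic q := by
  obtain rfl : x = f u := by simpa using hp 0
  obtain rfl : y = f v := by simpa using hp 1
  have h := (SimplyConnectedSpace.paths_homotopic P Q).map ⟨f, hf⟩
  have h1 : p = P.map hf := by ext t; exact hp t
  have h2 : q = Q.map hf := by ext t; exact hq t
  rw [h1, h2]
  exact h

/-- The boundary of a square in `S`. -/
theorem homotopic_of_square (X : C(I × I, S)) {a b c d : S} (p : Path a b) (q : Path c d)
    (l : Path a c) (r : Path b d) (hp : ∀ t, p t = X (0, t)) (hq : ∀ t, q t = X (1, t))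
    (hl : ∀ t, l t = X (t, 0)) (hr : ∀ t, r t = X (t, 1)) :
    p.Homotopic ((l.trans q).trans r.symm) := by
  let P : Path ((0, 0) : I × I) (0, 1) := ⟨⟨fun t => (0, t), by fun_prop⟩, rfl, rfl⟩
  let Q : Path ((1, 0) : I × I) (1, 1) := ⟨⟨fun t => (1, t), by fun_prop⟩, rfl, rfl⟩
  let L : Path ((0, 0) : I × I) (1, 0) := ⟨⟨fun t => (t, 0), by fun_prop⟩, rfl, rfl⟩
  let R : Path ((0, 1) : I × I) (1, 1) := ⟨⟨fun t => (t, 1), by fun_prop⟩, rfl, rfl⟩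
  have : ContractibleSpace I := (convex_Icc (0 : ℝ) 1).contractibleSpace ⟨0, by simp⟩
  refine homotopic_of_factor X.continuous P ((L.trans Q).trans R.symm) hp fun t => ?_
  simp only [Path.trans_apply, Path.symm_apply]
  split_ifs
  · exact hl _
  · exact hq _
  · exact hr _

end Tools

/-! ### Twisted loops and their homotopies -/

section TwistHomotopic

variable {S : Type*} [TopologicalSpace S]

/-- A homotopy through paths `p` with `p 0 = τ (p 1)`. -/
def TwistHomotopic (τ : S ≃ₜ S) (p q : C(I, S)) : Prop :=
  ContinuousMap.HomotopicWith p q fun f => τ (f 1) = f 0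

theorem TwistHomotopic.symm {τ : S ≃ₜ S} {p q : C(I, S)} (h : TwistHomotopic τ p q) :
    TwistHomotopic τ q p :=
  ContinuousMap.HomotopicWith.symm h

theorem TwistHomotopic.trans {τ : S ≃ₜ S} {p q r : C(I, S)} (h : TwistHomotopic τ p q)
    (h' : TwistHomotopic τ q r) : TwistHomotopic τ p r :=
  ContinuousMap.HomotopicWith.trans h h'

theorem TwistHomotopic.of_square {τ : S ≃ₜ S} {p q : C(I, S)} (X : C(I × I, S))
    (hX : ∀ r, τ (X (r, 1)) = X (r, 0)) (hp : ∀ t, X (0, t) = p t) (hq : ∀ t, X (1, t) = q t) :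
    TwistHomotopic τ p q :=
  ⟨{ toContinuousMap := X, map_zero_left := hp, map_one_left := hq, prop' := hX }⟩

theorem TwistHomotopic.exists_square {τ : S ≃ₜ S} {p q : C(I, S)} (h : TwistHomotopic τ p q) :
    ∃ X : C(I × I, S), (∀ r, τ (X (r, 1)) = X (r, 0)) ∧ (∀ t, X (0, t) = p t) ∧
      ∀ t, X (1, t) = q t := by
  obtain ⟨H⟩ := h
  exact ⟨H.toContinuousMap, H.prop', H.map_zero_left, H.map_one_left⟩

theorem TwistHomotopic.of_homotopic {τ : S ≃ₜ S} {x y : S} {p q : Path x y} (hxy : τ y = x)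
    (h : p.Homotopic q) : TwistHomotopic τ p q := by
  obtain ⟨H⟩ := h
  refine .of_square H.toContinuousMap (fun r => ?_) H.map_zero_left H.map_one_left
  exact (congrArg τ (H.target r)).trans (hxy.trans (H.source r).symm)

/-- Conjugating a path by a path `l` and its inverse image under `τ` is a twisted homotopy. -/
theorem TwistHomotopic.conj {τ : S ≃ₜ S} {x y x' y' : S} (l : Path x y) (w : Path y y')
    (r : Path x' y') (hr : ∀ t, τ (r t) = l t) :
    TwistHomotopic τ ((l.trans w).trans r.symm) w := by
  have hx : τ x' = x := by simpa using hr 0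
  have hy : τ y' = y := by simpa using hr 1
  -- At stage `a` the path follows `l` from `l a` on, then `w`, then `r` backwards only as far as `r
  -- a`. By `hr` its ends are matched by `τ` at every stage, and at `a = 1` only `w` and constant
  -- paths remain.
  let L : (a : I) → Path (l a) y := fun a => (l.subpath a 1).cast rfl l.target.symm
  let R : (a : I) → Path y' (r a) := fun a => (r.subpath 1 a).cast r.target.symm rfl
  have hL : Continuous fun p : I × I => L p.1 p.2 :=
    l.subpath_continuous_family.comp
      (by fun_prop : Continuous fun p : I × I => (p.1, (1 : I), p.2))
  have hR : Continuous fun p : I × I => R p.1 p.2 :=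
    r.subpath_continuous_family.comp
      (by fun_prop : Continuous fun p : I × I => ((1 : I), p.1, p.2))
  have hX : Continuous fun p : I × I => (((L p.1).trans w).trans (R p.1)) p.2 := by
    refine Path.trans_continuous_family (fun a => (L a).trans w) ?_ R hR
    exact Path.trans_continuous_family L hL (fun _ => w) (by fun_prop)
  have h1 : TwistHomotopic τ (((L 0).trans w).trans (R 0)) (((L 1).trans w).trans (R 1)) := by
    refine .of_square ⟨_, hX⟩ (fun a => ?_) (fun t => rfl) fun t => rfl
    simpa using hr a
  have h2 : TwistHomotopic τ (((L 0).trans w).trans (R 0)) ((l.trans w).trans r.symm) := by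
    have h3 : (((L 0).trans w).trans (R 0) : C(I, S)) = ((l.trans w).trans r.symm) := by
      ext t
      have h4 : ∀ s, L 0 s = l s := fun s => by simp [L, Path.subpath]
      have h5 : ∀ s, R 0 s = r.symm s := fun s => by
        simp only [R, Path.cast_coe, ← Path.symm_subpath r 0 1]
        simp only [Path.symm_apply, Path.subpath, Path.coe_mk_mk, Function.comp_apply]
        congr 1
        ext
        simp [Icc.coe_convexComb]
      simp only [ContinuousMap.coe_coe, Path.trans_apply, h4, h5]
    rw [h3]
    exact .of_homotopic hx (.refl _)
  have h6 : TwistHomotopic τ (((L 1).trans w).trans (R 1)) w := by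
    have h7 : (((L 1).trans w).trans (R 1) : C(I, S)) =
        (((Path.refl y).trans w).trans (Path.refl y')) := by
      ext t
      have h4 : ∀ s, L 1 s = y := fun s => by simp [L]
      have h5 : ∀ s, R 1 s = y' := fun s => by simp [R]
      simp only [ContinuousMap.coe_coe, Path.trans_apply, h4, h5, Path.refl_apply]
    rw [h7]
    refine .of_homotopic hy ?_
    exact (Path.Homotopic.trans_refl _).trans (Path.Homotopic.refl_trans _)
  exact (h2.symm.trans h1).trans h6

/-- The conclusion for a twisted homotopy: its ends are related by conjugation. -/
theorem TwistHomotopic.exists_conj {τ : S ≃ₜ S} {x y x' y' : S} {p : Path x x'} {w : Path y y'}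
    (h : TwistHomotopic τ p w) :
    ∃ (l : Path x y) (r : Path x' y'), (∀ t, τ (r t) = l t) ∧
      p.Homotopic ((l.trans w).trans r.symm) := by
  obtain ⟨X, hX, hp, hq⟩ := h.exists_square
  let l : Path x y := ⟨⟨fun t => X (t, 0), by fun_prop⟩, by simp [hp], by simp [hq]⟩
  let r : Path x' y' := ⟨⟨fun t => X (t, 1), by fun_prop⟩, by simp [hp], by simp [hq]⟩
  exact ⟨l, r, hX, homotopic_of_square X p w l r (fun t => (hp t).symm) (fun t => (hq t).symm)
    (fun _ => rfl) fun _ => rfl⟩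

end TwistHomotopic

/-! ### Lifting angles from the circle to the line -/

section Circ

theorem continuous_circ : Continuous circ :=
  Circle.exp.continuous.comp (by fun_prop)

theorem circ_add (a b : ℝ) : circ (a + b) = circ a * circ b := by
  simp [circ, mul_add]

theorem circ_eq_one_iff {a : ℝ} : circ a = 1 ↔ ∃ n : ℤ, a = n := by
  rw [circ, Circle.exp_eq_one]
  have := Real.pi_pos
  constructor
  · rintro ⟨n, hn⟩
    exact ⟨n, by field_simp at hn; linarith⟩
  · rintro ⟨n, rfl⟩
    exact ⟨n, by ring⟩

theorem circ_intCast (n : ℤ) : circ n = 1 := circ_eq_one_iff.2 ⟨n, rfl⟩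

theorem circ_eq_circ_iff {a b : ℝ} : circ a = circ b ↔ ∃ n : ℤ, a = b + n := by
  have h : circ a = circ (a - b) * circ b := by rw [← circ_add, sub_add_cancel]
  rw [h, mul_eq_right, circ_eq_one_iff]
  exact exists_congr fun n => ⟨fun h => by linarith, fun h => by linarith⟩

theorem exists_circ_eq (u : Circle) : ∃ t : I, circ t = u := by
  refine ⟨⟨Int.fract (Complex.arg u / (2 * Real.pi)), Int.fract_nonneg _,
    (Int.fract_lt_one _).le⟩, ?_⟩
  have h : circ (Complex.arg u / (2 * Real.pi)) = u := by
    rw [circ, mul_div_cancel₀ _ (by positivity), Circle.exp_arg]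
  refine Eq.trans ?_ h
  rw [circ_eq_circ_iff]
  refine ⟨-⌊Complex.arg u / (2 * Real.pi)⌋, ?_⟩
  rw [Int.cast_neg, ← sub_eq_add_neg, Int.self_sub_floor]

/-- Maps from a simply connected space to the circle have a logarithm. -/
theorem exists_lift_circ {Z : Type*} [TopologicalSpace Z] [SimplyConnectedSpace Z]
    [LocallyPathConnectedSpace Z] (u : C(Z, Circle)) (z : Z) {a : ℝ} (ha : circ a = u z) :
    ∃ θ : C(Z, ℝ), θ z = a ∧ ∀ x, circ (θ x) = u x := by
  obtain ⟨θ, ⟨h1, h2⟩, -⟩ := Circle.isCoveringMap_exp.existsUnique_continuousMap_lifts u z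
    (2 * Real.pi * a) ha
  refine ⟨⟨fun x => θ x / (2 * Real.pi), by fun_prop⟩, ?_, fun x => ?_⟩
  · simp [h1]
  · rw [circ]
    simp only [ContinuousMap.coe_mk]
    rw [mul_div_cancel₀ _ (by positivity)]
    exact congrFun h2 x

/-- Two lifts of the same map to the circle that agree at a point are equal. -/
theorem lift_circ_unique {Z : Type*} [TopologicalSpace Z] [PreconnectedSpace Z] {θ η : Z → ℝ}
    (hθ : Continuous θ) (hη : Continuous η) (h : ∀ x, circ (θ x) = circ (η x)) {z : Z}
    (hz : θ z = η z) : θ = η := by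
  have h1 := Circle.isCoveringMap_exp.eq_of_comp_eq (g₁ := fun x => 2 * Real.pi * θ x)
    (g₂ := fun x => 2 * Real.pi * η x) (by fun_prop) (by fun_prop) (funext h) z (by rw [hz])
  ext x
  have h2 := congrFun h1 x
  have := Real.pi_pos
  simp only [mul_eq_mul_left_iff] at h2
  rcases h2 with h2 | h2
  · exact h2
  · linarith

end Circ

section QuotientAlgebra

variable {S : Type*} [TopologicalSpace S] {x y z : S}

open Path.Homotopic

theorem symm_trans_cancel (p : Path.Homotopic.Quotient x y) (q : Path.Homotopic.Quotient y z) :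
    p.symm.trans (p.trans q) = q := by
  rw [← Quotient.trans_assoc, Quotient.symm_trans, Quotient.refl_trans]

end QuotientAlgebra

/-! ### The winding invariant of twisted loops near a vanishing cycle -/

namespace Curve

variable {S : Type*} [TopologicalSpace S] {b : S} (V : Curve b)

theorem twist_of_notMem {x : S} (hx : x ∉ V.annulus '' openAnnulus) : V.twist x = x := by
  by_cases hb : x ∈ Set.range V.annulus
  · obtain ⟨⟨u, v⟩, rfl⟩ := hb
    have hv : ¬ (0 < (v : ℝ) ∧ (v : ℝ) < 1) := fun h => hx ⟨(u, v), h, rfl⟩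
    rw [V.twist_annulus]
    have : (v : ℝ) = 0 ∨ (v : ℝ) = 1 := by
      by_contra! h
      exact hv ⟨lt_of_le_of_ne v.2.1 (Ne.symm h.1), lt_of_le_of_ne v.2.2 h.2⟩
    rcases this with h | h <;> rw [h] <;> simp [circ_zero, circ_one]
  · exact V.twist_off x hb

theorem annulus_mem_iff {u : Circle} {v : I} :
    V.annulus (u, v) ∈ V.annulus '' openAnnulus ↔ 0 < (v : ℝ) ∧ (v : ℝ) < 1 := by
  rw [V.annulus_injective.mem_set_image]
  rfl

theorem annulus_mem_core_iff {u : Circle} {v : I} :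
    V.annulus (u, v) ∈ V.core ↔ (v : ℝ) = 1 / 2 := by
  rw [core, V.annulus_injective.mem_set_image]
  rfl

theorem core_subset : V.core ⊆ V.annulus '' openAnnulus := by
  rintro _ ⟨⟨u, v⟩, hv, rfl⟩
  rw [annulus_mem_iff]
  simp only [mem_ofPred_eq] at hv
  rw [hv]
  norm_num

/-- The loop that winds `m` times around the boundary curve `S¹ × {0}`. -/
def wind (m : ℤ) : Path (V.annulus (1, 0)) (V.annulus (1, 0)) where
  toFun t := V.annulus (circ (t * m), 0)
  continuous_toFun := V.annulus_continuous.comp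
    ((continuous_circ.comp (by fun_prop)).prodMk continuous_const)
  source' := by simp [circ_zero]
  target' := by simp [circ_intCast]

theorem wind_apply (m : ℤ) (t : I) : V.wind m t = V.annulus (circ (t * m), 0) := rfl

/-- Both sides come from paths in `ℝ` with common ends, and `ℝ` is simply connected. -/
theorem wind_trans_wind (m n : ℤ) :
    ((V.wind m).trans (V.wind n)).Homotopic (V.wind (m + n)) := by
  let P : Path (0 : ℝ) m := ⟨⟨fun t => t * m, by fun_prop⟩, by simp, by simp⟩
  let Q : Path (m : ℝ) (m + n) := ⟨⟨fun t => m + t * n, by fun_prop⟩, by simp, by simp⟩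
  let R : Path (0 : ℝ) (m + n) := ⟨⟨fun t => t * (m + n), by fun_prop⟩, by simp, by simp⟩
  refine homotopic_of_factor (f := fun a : ℝ => V.annulus (circ a, 0))
    (V.annulus_continuous.comp (continuous_circ.prodMk continuous_const)) (P.trans Q) R
    (fun t => ?_) fun t => ?_
  · simp only [Path.trans_apply]
    split_ifs
    · rfl
    · simp only [wind_apply, Q, Path.coe_mk_mk, circ_add, circ_intCast, one_mul]
  · simp [wind_apply, R]

/-- Covers both branches of `loopPow` at once: `e = 1` for powers of the based loop, `e = -1` for
powers of its inverse. The arcs between consecutive factors cancel. -/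
theorem natRec_homotopic {γ : Path b b} {e : ℤ}
    (hγ : γ.Homotopic ((V.arc.trans (V.wind e)).trans V.arc.symm)) (n : ℕ) :
    Path.Homotopic (Nat.rec (Path.refl b) (fun _ p => p.trans γ) n : Path b b)
      ((V.arc.trans (V.wind (n * e))).trans V.arc.symm) := by
  induction n with
  | zero =>
    have h0 : V.wind (((0 : ℕ) : ℤ) * e) = Path.refl _ := by
      ext t; simp [wind_apply, circ_zero]
    rw [h0]
    rw [← Path.Homotopic.Quotient.eq]
    simp
  | succ n ih =>
    rw [← Path.Homotopic.Quotient.eq] at ih hγ ⊢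
    have h1 := Path.Homotopic.Quotient.eq.2 (V.wind_trans_wind (n * e) e)
    rw [show ((n + 1 : ℕ) : ℤ) * e = n * e + e by push_cast; ring]
    simp only [Path.Homotopic.Quotient.mk_trans, Path.Homotopic.Quotient.mk_symm] at ih hγ h1 ⊢
    rw [ih, hγ, ← h1]
    simp [Path.Homotopic.Quotient.trans_assoc, symm_trans_cancel]

theorem loopPow_homotopic (m : ℤ) :
    (loopPow V.basedLoop m).Homotopic ((V.arc.trans (V.wind m)).trans V.arc.symm) := by
  have h1 : V.pushOff = V.wind 1 := by
    ext t; simp [wind_apply, pushOff]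
  have h2 : V.pushOff.symm = V.wind (-1) := by
    ext t
    have h3 : circ (unitInterval.symm t) = circ (t * (-1 : ℤ)) := by
      rw [circ_eq_circ_iff]
      exact ⟨1, by rw [unitInterval.coe_symm_eq]; push_cast; ring⟩
    change V.annulus (circ (unitInterval.symm t), 0) = V.annulus (circ (t * (-1 : ℤ)), 0)
    rw [h3]
  cases m with
  | ofNat n =>
    have := V.natRec_homotopic (γ := V.basedLoop) (e := 1) (by rw [← h1]; exact .refl _) n
    rw [mul_one] at this
    exact this
  | negSucc n =>
    have h3 : V.basedLoop.symm.Homotopic ((V.arc.trans (V.wind (-1))).trans V.arc.symm) := by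
      rw [← h2, ← Path.Homotopic.Quotient.eq]
      simp [basedLoop, Path.trans_symm, Path.Homotopic.Quotient.trans_assoc]
    have := V.natRec_homotopic h3 (n + 1)
    rw [show ((n + 1 : ℕ) : ℤ) * -1 = Int.negSucc n by omega] at this
    exact this

/-- A twisted path inside the annulus can be pushed to the boundary curve. -/
theorem twistHomotopic_wind {p : C(I, S)} {θ : I → ℝ} {v : I → I} (hθ : Continuous θ)
    (hv : Continuous v) (hp : ∀ t, p t = V.annulus (circ (θ t), v t)) {m : ℤ} (hv01 : v 1 = v 0)
    (hm : θ 1 + v 0 - θ 0 = m) : TwistHomotopic V.twist p (V.wind m) := by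
  -- The angle moves linearly to `t * m` while the height shrinks to `0`. The quantity "final angle
  -- plus height minus initial angle" equals `m` at both ends and is affine in the homotopy
  -- parameter, so it stays `m` and the loop stays twisted.
  let X : C(I × I, S) :=
    ⟨fun q => V.annulus (circ ((1 - q.1) * θ q.2 + q.1 * (q.2 * m)), unitInterval.symm q.1 * v q.2),
      V.annulus_continuous.comp ((continuous_circ.comp (by fun_prop)).prodMk (by fun_prop))⟩
  refine .of_square X (fun r => ?_) (fun t => ?_) fun t => ?_
  · simp only [X, ContinuousMap.coe_mk, V.twist_annulus, hv01]
    congr 2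
    rw [← circ_add, circ_eq_circ_iff]
    refine ⟨m, ?_⟩
    simp only [Icc.coe_one, Icc.coe_zero, Icc.coe_mul, unitInterval.coe_symm_eq]
    linear_combination (1 - (r : ℝ)) * hm
  · simp [X, hp]
  · simp [X, wind_apply]

/-- The classification of twisted loops up to twisted homotopy, in terms of based loops. -/
theorem exists_conj_loopPow_iff (β : Path b b) (m : ℤ) :
    (∃ ζ : Path b b, β.Homotopic ((ζ.trans (loopPow V.basedLoop m)).trans
      (pullLoop V.twist V.twist_base ζ.symm))) ↔ TwistHomotopic V.twist β (V.wind m) := by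
  -- The arc is fixed by the twist, so it can be absorbed into the conjugating path on both sides.
  have harc : ∀ t, V.twist (V.arc t) = V.arc t := fun t => V.twist_of_notMem (V.arc_notMem t)
  have hpow := Path.Homotopic.Quotient.eq.2 (V.loopPow_homotopic m)
  simp only [Path.Homotopic.Quotient.mk_trans, Path.Homotopic.Quotient.mk_symm] at hpow
  constructor
  · rintro ⟨ζ, hζ⟩
    let ζ' : Path b b := pullLoop V.twist V.twist_base ζ
    have hζ' : ∀ t, V.twist (ζ' t) = ζ t := fun t => V.twist.apply_symm_apply _
    have h1 : pullLoop V.twist V.twist_base ζ.symm = ζ'.symm := by ext t; rfl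
    have h2 : β.Homotopic (((ζ.trans V.arc).trans (V.wind m)).trans (ζ'.trans V.arc).symm) := by
      refine hζ.trans ?_
      rw [h1, ← Path.Homotopic.Quotient.eq]
      simp [hpow, Path.trans_symm, Path.Homotopic.Quotient.trans_assoc]
    refine (TwistHomotopic.of_homotopic V.twist_base h2).trans (.conj _ _ _ fun t => ?_)
    simp only [Path.trans_apply]
    split_ifs
    · exact hζ' _
    · exact harc _
  · intro h
    obtain ⟨l, r, hr, hβ⟩ := h.exists_conj
    -- `l` leads from `b` to the boundary curve; returning along the arc closes it to a based loop.
    refine ⟨l.trans V.arc.symm, hβ.trans ?_⟩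
    have h1 : pullLoop V.twist V.twist_base (l.trans V.arc.symm).symm =
        (r.trans V.arc.symm).symm := by
      ext t
      simp only [pullLoop, Path.cast_coe, Path.map_coe, Function.comp_apply, Path.symm_apply,
        Homeomorph.symm_apply_eq, Path.trans_apply]
      split_ifs
      · exact (hr _).symm
      · exact (harc _).symm
    rw [h1, ← Path.Homotopic.Quotient.eq]
    simp [hpow, Path.trans_symm, Path.Homotopic.Quotient.trans_assoc, symm_trans_cancel]

/-- Every point outside the open annulus can be joined, outside the open annulus, to one of the
two boundary curves. -/
theorem exists_path_to_boundary [CompactSpace S] [T2Space S] [PathConnectedSpace S] {x : S}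
    (hx : x ∉ V.annulus '' openAnnulus) :
    ∃ j : I, (j = 0 ∨ j = 1) ∧ ∃ γ : Path x (V.annulus (1, j)),
      ∀ t, γ t ∉ V.annulus '' openAnnulus := by
  obtain ⟨γ⟩ := PathConnectedSpace.joined x (V.annulus (1, 0))
  have hcl : IsClosed {t : I | γ t ∈ range V.annulus} :=
    (isCompact_range V.annulus_continuous).isClosed.preimage γ.continuous
  -- The first time at which the path meets the closed annulus. An entry into the open annulus would
  -- have to be preceded by earlier such times, so the first contact is on a boundary curve.
  obtain ⟨t₀, ht₀, hmin⟩ := hcl.isCompact.exists_isLeast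
    ⟨1, (1, 0), γ.target.symm⟩
  have hoff : ∀ t ≤ t₀, γ t ∉ V.annulus '' openAnnulus := by
    intro t ht hmem
    have ht₀' : t = t₀ := le_antisymm ht (hmin (image_subset_range _ _ hmem))
    subst ht₀'
    rcases eq_or_ne t 0 with rfl | h0
    · exact hx (by simpa using hmem)
    have h1 : ∀ᶠ s in 𝓝 t, γ s ∈ V.annulus '' openAnnulus :=
      γ.continuous.continuousAt.eventually (V.isOpen_annulus.mem_nhds hmem)
    have : (𝓝[<] t).NeBot := nhdsLT_neBot_of_exists_lt ⟨0, lt_of_le_of_ne t.2.1 (Ne.symm h0)⟩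
    obtain ⟨s, hs, hst⟩ := ((h1.filter_mono nhdsWithin_le_nhds).and
      (eventually_mem_nhdsWithin (s := Iio t))).exists
    exact absurd (hmin (image_subset_range _ _ hs)) (not_le.2 hst)
  obtain ⟨⟨u, j⟩, huj⟩ := ht₀
  have hj : j = 0 ∨ j = 1 := by
    have h1 := hoff t₀ le_rfl
    rw [← huj, annulus_mem_iff] at h1
    by_contra! h
    exact h1 ⟨lt_of_le_of_ne j.2.1 fun h' => h.1 (Subtype.ext h'.symm),
      lt_of_le_of_ne j.2.2 fun h' => h.2 (Subtype.ext h')⟩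
  refine ⟨j, hj, ?_⟩
  obtain ⟨a, ha⟩ := exists_circ_eq u
  let γ₁ : Path x (V.annulus (u, j)) := (γ.subpath 0 t₀).cast (by simp) huj
  let γ₂ : Path (V.annulus (u, j)) (V.annulus (1, j)) :=
    ⟨⟨fun t => V.annulus (circ ((1 - t) * a), j), V.annulus_continuous.comp
      ((continuous_circ.comp (by fun_prop)).prodMk continuous_const)⟩, by simp [ha],
      by simp [circ_zero]⟩
  refine ⟨γ₁.trans γ₂, fun t => ?_⟩
  rw [Path.trans_apply]
  split_ifs
  · have h1 : ∀ s : I, γ.subpath 0 t₀ s ∉ V.annulus '' openAnnulus := by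
      intro s
      have h2 : γ.subpath 0 t₀ s ∈ γ '' Icc 0 t₀ := by
        rw [← γ.range_subpath_of_le 0 t₀ t₀.2.1]
        exact mem_range_self s
      obtain ⟨s', hs', h3⟩ := h2
      rw [← h3]
      exact hoff s' hs'.2
    exact h1 _
  · simp only [γ₂, Path.coe_mk_mk]
    rw [annulus_mem_iff]
    rcases hj with rfl | rfl <;> simp

/-- A constant path outside the open annulus. -/
theorem twistHomotopic_const [CompactSpace S] [T2Space S] [PathConnectedSpace S] {x : S}
    (hx : x ∉ V.annulus '' openAnnulus) :
    ∃ m : ℤ, m ∈ ({0, 1} : Set ℤ) ∧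
      TwistHomotopic V.twist (ContinuousMap.const I x) (V.wind m) := by
  obtain ⟨j, hj, γ, hγ⟩ := V.exists_path_to_boundary hx
  obtain ⟨m, hm, hmj⟩ : ∃ m : ℤ, m ∈ ({0, 1} : Set ℤ) ∧ (j : ℝ) = m := by
    rcases hj with rfl | rfl
    · exact ⟨0, by simp, by simp⟩
    · exact ⟨1, by simp, by simp⟩
  refine ⟨m, hm, ?_⟩
  have h1 : TwistHomotopic V.twist (ContinuousMap.const I x)
      (ContinuousMap.const I (V.annulus (1, j))) :=
    .of_square ⟨fun q => γ q.1, by fun_prop⟩ (fun r => V.twist_of_notMem (hγ r)) (by simp) (by simp)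
  -- A constant loop at height `j` has no change of angle, so its invariant is `j`, that is `0` or
  -- `1`.
  exact h1.trans (V.twistHomotopic_wind (θ := fun _ => 0) (v := fun _ => j) continuous_const
    continuous_const (by simp [circ_zero]) rfl (by simpa using hmj))

end Curve

/-! ### Polar coordinates as a quotient map -/

section Polar

/-- A continuous function on a compact space that is constant on the fibres of `q` descends to a
continuous function on the range of `q`. -/
theorem exists_continuousOn_descend {X Y Z : Type*} [TopologicalSpace X] [CompactSpace X]
    [TopologicalSpace Y] [T2Space Y] [TopologicalSpace Z] [Nonempty Z] {q : X → Y} {f : X → Z}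
    (hq : Continuous q) (hf : Continuous f) (h : ∀ a b, q a = q b → f a = f b) :
    ∃ g : Y → Z, ContinuousOn g (range q) ∧ ∀ a, g (q a) = f a := by
  let g : Y → Z := Function.extend q f fun _ => Classical.arbitrary Z
  have hg : ∀ a, g (q a) = f a :=
    fun a => Function.FactorsThrough.extend_apply (fun a b hab => h a b hab) _ a
  refine ⟨g, ?_, hg⟩
  rw [continuousOn_iff_continuous_domRestrict]
  have hq' : Continuous (rangeFactorization q) := hq.subtype_mk _
  rw [(hq'.isClosedMap.isQuotientMap hq' rangeFactorization_surjective).continuous_iff]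
  exact hf.congr fun a => (hg a).symm

/-- Polar coordinates on the unit disk. -/
def polar (p : I × I) : ℂ := (p.1 : ℝ) * circ p.2

theorem continuous_polar : Continuous polar := by
  have : Continuous fun p : I × I => ((circ p.2 : Circle) : ℂ) :=
    continuous_subtype_val.comp (continuous_circ.comp (by fun_prop))
  exact (Complex.continuous_ofReal.comp (by fun_prop)).mul this

theorem norm_polar (p : I × I) : ‖polar p‖ = p.1 := by
  rw [polar, norm_mul, Circle.norm_coe, mul_one, Complex.norm_real, Real.norm_of_nonneg p.1.2.1]

theorem polar_mem (p : I × I) : polar p ∈ closedBall (0 : ℂ) 1 := by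
  rw [mem_closedBall_zero_iff, norm_polar]
  exact p.1.2.2

theorem range_polar : range polar = closedBall 0 1 := by
  refine Subset.antisymm (range_subset_iff.2 polar_mem) fun w hw => ?_
  have hw1 : ‖w‖ ≤ 1 := by simpa using hw
  obtain ⟨t, ht⟩ := exists_circ_eq (Circle.exp (Complex.arg w))
  refine ⟨(⟨‖w‖, norm_nonneg _, hw1⟩, t), ?_⟩
  simp only [polar, ht, Circle.coe_exp]
  exact Complex.norm_mul_exp_arg_mul_I w

theorem polar_zero (t : I) : polar (0, t) = 0 := by simp [polar]

theorem polar_one (t : I) : polar (1, t) = circ t := by simp [polar]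

theorem circ_eq_circ_iff_of_mem {t t' : I} :
    circ t = circ t' ↔ t = t' ∨ (t = 0 ∧ t' = 1) ∨ (t = 1 ∧ t' = 0) := by
  constructor
  · intro h
    obtain ⟨n, hn⟩ := circ_eq_circ_iff.1 h
    have h1 := t.2.1
    have h2 := t.2.2
    have h3 := t'.2.1
    have h4 := t'.2.2
    have hn1 : (-1 : ℝ) ≤ n := by linarith
    have hn2 : (n : ℝ) ≤ 1 := by linarith
    have hn1' : -1 ≤ n := by exact_mod_cast hn1
    have hn2' : n ≤ 1 := by exact_mod_cast hn2
    rcases (by omega : n = -1 ∨ n = 0 ∨ n = 1) with rfl | rfl | rfl <;> push_cast at hn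
    · exact Or.inr (Or.inl ⟨Subtype.ext (by rw [Icc.coe_zero]; linarith),
        Subtype.ext (by rw [Icc.coe_one]; linarith)⟩)
    · exact Or.inl (Subtype.ext (by linarith))
    · exact Or.inr (Or.inr ⟨Subtype.ext (by rw [Icc.coe_one]; linarith),
        Subtype.ext (by rw [Icc.coe_zero]; linarith)⟩)
  · rintro (rfl | ⟨rfl, rfl⟩ | ⟨rfl, rfl⟩) <;> simp [Curve.circ_zero, Curve.circ_one]

/-- Lists the identifications that a function on the square must respect to descend to the disk: the
side `r = 0` is collapsed, and the sides `t = 0` and `t = 1` are glued. -/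
theorem polar_eq_polar {p q : I × I} (h : polar p = polar q) :
    p = q ∨ (p.1 = 0 ∧ q.1 = 0) ∨ (p.1 = q.1 ∧ p.2 = 0 ∧ q.2 = 1) ∨
      (p.1 = q.1 ∧ p.2 = 1 ∧ q.2 = 0) := by
  have h1 : p.1 = q.1 := Subtype.ext (by rw [← norm_polar p, ← norm_polar q, h])
  rcases eq_or_ne p.1 0 with h0 | h0
  · exact Or.inr (Or.inl ⟨h0, h1 ▸ h0⟩)
  have h2 : circ p.2 = circ q.2 := by
    have h3 : ((p.1 : ℝ) : ℂ) ≠ 0 := by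
      simpa using fun h => h0 (Subtype.ext h)
    have h4 : polar q = (p.1 : ℝ) * circ q.2 := by rw [polar, h1]
    rw [h4, polar] at h
    exact Subtype.ext (mul_left_cancel₀ h3 h)
  rcases circ_eq_circ_iff_of_mem.1 h2 with h | h | h
  · exact Or.inl (Prod.ext h1 h)
  · exact Or.inr (Or.inr (Or.inl ⟨h1, h⟩))
  · exact Or.inr (Or.inr (Or.inr ⟨h1, h⟩))

end Polar

/-! ### Sections over a disk around one critical value -/

namespace Factorization

variable {E : Type*} [TopologicalSpace E] [ChartedSpace (EuclideanHalfSpace 4) E]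
  {π : E → ℂ} {S : Type*} [TopologicalSpace S] {b : S} {k : ℕ} (F : Factorization π S b k)

theorem proj_transport (i : Fin k) (r t : I) (x : S) :
    π (F.transport i (r, t, x)) = F.disk i (polar (r, t)) :=
  F.transport_proj i r t x

/-- A twisted loop that is twisted homotopic to a multiple of the vanishing cycle gives a section
over the corresponding disk. -/
theorem exists_section_of_twistHomotopic (i : Fin k) {β : C(I, S)} {m : ℤ}
    (h : TwistHomotopic (F.V i).twist β ((F.V i).wind m)) :
    ∃ ψ : ℂ → E, ContinuousOn ψ (closedBall 0 1) ∧
      (∀ w ∈ closedBall (0 : ℂ) 1, π (ψ w) = F.disk i w) ∧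
      (∀ t : I, ψ (circ t) = F.transport i (1, t, β t)) ∧
      (m ∈ ({0, 1} : Set ℤ) → ψ 0 ≠ F.crit i) := by
  set V := F.V i
  -- The height of the loop `p` placed over the centre. For `m = 0, 1` it is the constant loop on
  -- the boundary curve at height `m`, which maps to a regular point; otherwise it lies on the core
  -- and collapses to the critical point, whatever its winding. Angular speed `m - v` gives the
  -- invariant `m` in both cases.
  obtain ⟨v, hv, hv'⟩ : ∃ v : I, (m ∈ ({0, 1} : Set ℤ) → (v : ℝ) = m) ∧
      (m ∉ ({0, 1} : Set ℤ) → (v : ℝ) = 1 / 2) := by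
    by_cases hm : m ∈ ({0, 1} : Set ℤ)
    · refine ⟨⟨m, ?_⟩, fun _ => rfl, fun h => absurd hm h⟩
      rcases hm with rfl | rfl <;> simp
    · exact ⟨⟨1 / 2, by norm_num⟩, fun h => absurd h hm, fun _ => rfl⟩
  let p : C(I, S) := ⟨fun t => V.annulus (circ (t * (m - v)), v), V.annulus_continuous.comp
    ((continuous_circ.comp (by fun_prop)).prodMk continuous_const)⟩
  have hp : TwistHomotopic V.twist p (V.wind m) :=
    V.twistHomotopic_wind (θ := fun t => t * (m - v)) (v := fun _ => v) (by fun_prop)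
      continuous_const (fun t => rfl) rfl (by simp)
  obtain ⟨X, hX, hX0, hX1⟩ := (hp.trans h.symm).exists_square
  have hcenter : ∀ t : I, F.transport i (0, t, p t) = F.transport i (0, 0, p 0) := by
    intro t
    by_cases hm : m ∈ ({0, 1} : Set ℤ)
    · have h1 : ∀ t, p t = V.annulus (1, v) := fun t => by
        simp [p, hv hm, Curve.circ_zero]
      rw [h1, h1]
      refine F.transport_flat i t _ ?_
      rw [V.annulus_mem_iff, hv hm]
      rcases hm with rfl | rfl <;> simp
    · have h1 : ∀ t, p t ∈ V.core := fun t => V.annulus_mem_core_iff.2 (hv' hm)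
      rw [(F.transport_vanishing i t _).2 (h1 t), (F.transport_vanishing i 0 _).2 (h1 0)]
  have : Nonempty E := ⟨F.crit i⟩
  obtain ⟨ψ, hψ, hψX⟩ := exists_continuousOn_descend (q := polar)
    (f := fun a : I × I => F.transport i (a.1, a.2, X a)) continuous_polar
    ((F.transport_continuous i).comp (by fun_prop)) (by
      rintro ⟨r, t⟩ ⟨r', t'⟩ hab
      rcases polar_eq_polar hab with h | ⟨h1, h2⟩ | ⟨h1, h2, h3⟩ | ⟨h1, h2, h3⟩
      · rw [h]
      · simp only at h1 h2
        subst h1 h2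
        simp only [hX0]
        rw [hcenter, hcenter t']
      · simp only at h1 h2 h3 ⊢
        subst h1 h2 h3
        rw [F.transport_monodromy, hX]
      · simp only at h1 h2 h3 ⊢
        subst h1 h2 h3
        rw [F.transport_monodromy, hX])
  rw [range_polar] at hψ
  refine ⟨ψ, hψ, fun w hw => ?_, fun t => ?_, fun hm => ?_⟩
  · rw [← range_polar] at hw
    obtain ⟨⟨r, t⟩, rfl⟩ := hw
    rw [hψX]
    exact F.proj_transport i r t _
  · rw [← polar_one, hψX]
    simp only [hX1]
  · rw [← polar_zero 0, hψX]
    simp only [hX0, ne_eq]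
    rw [F.transport_vanishing]
    intro hc
    rw [show p 0 = V.annulus (circ (((0 : I) : ℝ) * (m - v)), v) from rfl,
      V.annulus_mem_core_iff, hv hm] at hc
    rcases hm with rfl | rfl <;> norm_num at hc

/-- Only the core is collapsed, so every other point of the singular fibre has a well-defined
position in `S`, which may depend on the angle `t`. -/
theorem transport_zero_unique (i : Fin k) (t : I) {y : E} (hy : y ≠ F.crit i)
    (hyπ : π y = F.disk i 0) : ∃! x, F.transport i (0, t, x) = y := by
  obtain ⟨x, hx⟩ := F.transport_surj i 0 t y (by simpa using hyπ)
  refine ⟨x, hx, fun x' hx' => ?_⟩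
  have hcore : ∀ x', F.transport i (0, t, x') = y → x' ∈ (F.V i).coreᶜ := fun x' hx' hc =>
    hy (hx' ▸ (F.transport_vanishing i t x').2 hc)
  exact F.transport_inj_off i t (hcore _ hx') (hcore _ hx) (hx'.trans hx.symm)

variable [CompactSpace S] [T2Space S] [T2Space E]

/-- The twisted loop of a section over a disk that avoids the critical point. -/
theorem exists_const_of_transport_zero [PathConnectedSpace S] (i : Fin k) {p : C(I, S)} {y : E}
    (hy : y ≠ F.crit i) (hp : ∀ t, F.transport i (0, t, p t) = y) :
    ∃ m : ℤ, m ∈ ({0, 1} : Set ℤ) ∧ TwistHomotopic (F.V i).twist p ((F.V i).wind m) := by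
  set V := F.V i
  have hdisk : ∀ t x, π (F.transport i (0, t, x)) = F.disk i 0 := fun t x => by
    rw [F.proj_transport, polar_zero]
  have hyπ : π y = F.disk i 0 := by rw [← hp 0, hdisk]
  by_cases h0 : p 0 ∈ V.annulus '' openAnnulus
  · obtain ⟨⟨u, v⟩, hv, huv⟩ := h0
    have hv2 : (v : ℝ) ≠ 1 / 2 := by
      intro h
      apply hy
      rw [← hp 0, F.transport_vanishing, ← huv]
      exact V.annulus_mem_core_iff.2 h
    -- `y` is pushed to the boundary curve on its own side of the core, so that it never meets the
    -- critical point.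
    obtain ⟨j, hj, hjv⟩ : ∃ j : I, (j = 0 ∨ j = 1) ∧
        ∀ a : I, (Icc.convexComb v j a : ℝ) ≠ 1 / 2 := by
      rcases lt_or_gt_of_ne hv2 with h | h
      · refine ⟨0, Or.inl rfl, fun a => ?_⟩
        rw [Icc.coe_convexComb]
        simp only [Icc.coe_zero, mul_zero, add_zero]
        have := mul_nonneg a.2.1 v.2.1
        nlinarith
      · refine ⟨1, Or.inr rfl, fun a => ?_⟩
        rw [Icc.coe_convexComb]
        simp only [Icc.coe_one, mul_one]
        have := mul_nonneg a.2.1 (sub_nonneg.2 v.2.2)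
        nlinarith
    let y' : I → E := fun a => F.transport i (0, 0, V.annulus (u, Icc.convexComb v j a))
    have hy'c : Continuous y' := (F.transport_continuous i).comp
      (continuous_const.prodMk (continuous_const.prodMk (V.annulus_continuous.comp
        (continuous_const.prodMk (Icc.continuous_convexComb_prod.comp (by fun_prop :
          Continuous fun a : I => (v, j, a)))))))
    have hy' : ∀ a, y' a ≠ F.crit i := fun a ha =>
      hjv a (V.annulus_mem_core_iff.1 ((F.transport_vanishing i 0 _).1 ha))
    obtain ⟨X, hX⟩ := exists_continuous_solution
      (P := fun a : (I × I) × S => F.transport i (0, a.1.2, a.2)) (Q := fun a : I × I => y' a.1)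
      ((F.transport_continuous i).comp (by fun_prop)) (hy'c.comp continuous_fst)
      (fun a => F.transport_zero_unique i a.2 (hy' a.1) (hdisk _ _))
    have hX' : ∀ a : I × I, F.transport i (0, a.2, X a) = y' a.1 := fun a => (hX a _).2 rfl
    have hy0 : y' 0 = y := by simp [y', huv, hp]
    have hoff : V.annulus (u, j) ∉ V.annulus '' openAnnulus := by
      rw [V.annulus_mem_iff]
      rcases hj with rfl | rfl <;> simp
    have h1 : TwistHomotopic V.twist p (ContinuousMap.const I (V.annulus (u, j))) := by
      refine .of_square X (fun r => ?_) (fun t => ?_) fun t => ?_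
      · rw [← hX (r, 0)]
        simp only
        rw [← F.transport_monodromy]
        exact hX' (r, 1)
      · refine ((hX (0, t) (p t)).1 ?_).symm
        simp [hp, hy0]
      · refine ((hX (1, t) _).1 ?_).symm
        simp only [ContinuousMap.const_apply]
        rw [F.transport_flat i t _ hoff]
        simp [y']
    obtain ⟨m, hm, hmj⟩ := V.twistHomotopic_const hoff
    exact ⟨m, hm, h1.trans hmj⟩
  -- Outside the open annulus the transport at `r = 0` does not depend on the angle, so the loop is
  -- already constant.
  · have h1 : p = ContinuousMap.const I (p 0) := by
      ext t
      refine (F.transport_zero_unique i t hy hyπ).unique (hp t) ?_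
      rw [ContinuousMap.const_apply, F.transport_flat i t _ h0, hp]
    rw [h1]
    exact V.twistHomotopic_const h0

/-- The twisted loop of a section over a disk. -/
theorem exists_twistHomotopic_of_section [PathConnectedSpace S] (i : Fin k) {ψ : ℂ → E}
    (hψ : ContinuousOn ψ (closedBall 0 1))
    (hψπ : ∀ w ∈ closedBall (0 : ℂ) 1, π (ψ w) = F.disk i w) {β : C(I, S)}
    (hβ : ∀ t, F.transport i (1, t, β t) = ψ (circ t)) :
    ∃ m : ℤ, TwistHomotopic (F.V i).twist β ((F.V i).wind m) ∧
      (ψ 0 ≠ F.crit i → m ∈ ({0, 1} : Set ℤ)) := by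
  set V := F.V i
  have hΨ : Continuous fun a : I × I => ψ (polar a) :=
    hψ.comp_continuous continuous_polar polar_mem
  have hP : Continuous fun a : (I × I) × S => F.transport i (a.1.1, a.1.2, a.2) :=
    (F.transport_continuous i).comp (by fun_prop)
  have hmono : ∀ r : I, polar (r, 1) = polar (r, 0) := fun r => by
    simp [polar, Curve.circ_zero, Curve.circ_one]
  have huniq : ∀ a : I × I, a.1 ≠ 0 → ∃! x, F.transport i (a.1, a.2, x) = ψ (polar a) := by
    intro a ha
    obtain ⟨x, hx⟩ := F.transport_surj i a.1 a.2 (ψ (polar a)) (hψπ _ (polar_mem a))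
    exact ⟨x, hx, fun x' hx' => F.transport_inj i a.1 a.2 ha (hx'.trans hx.symm)⟩
  by_cases hcrit : ψ 0 = F.crit i
  · -- the section passes through the critical point
    obtain ⟨r₀, hr₀, hin⟩ : ∃ r₀ : I, 0 < r₀ ∧ ∀ t x, F.transport i (r₀, t, x) = ψ (polar (r₀, t)) →
        x ∈ V.annulus '' openAnnulus := by
      -- The radii at which the section leaves the annulus form a compact set. It misses `0`,
      -- because over the centre the section lies on the core; hence it misses all small radii.
      let G : Set ((I × I) × S) := {a | F.transport i (a.1.1, a.1.2, a.2) = ψ (polar a.1)} ∩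
        Prod.snd ⁻¹' (V.annulus '' openAnnulus)ᶜ
      have hG : IsClosed G := (isClosed_eq hP (hΨ.comp continuous_fst)).inter
        (V.isOpen_annulus.isClosed_compl.preimage continuous_snd)
      have himg : IsClosed ((fun a : (I × I) × S => a.1.1) '' G) :=
        (hG.isCompact.image (by fun_prop)).isClosed
      have h0 : (0 : I) ∉ (fun a : (I × I) × S => a.1.1) '' G := by
        rintro ⟨⟨⟨r, t⟩, x⟩, ⟨h1, h2⟩, h3⟩
        simp only at h3
        subst h3
        simp only [mem_ofPred_eq, polar_zero, hcrit, F.transport_vanishing] at h1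
        exact h2 (V.core_subset h1)
      have : (𝓝[>] (0 : I)).NeBot := nhdsGT_neBot_of_exists_gt ⟨1, zero_lt_one⟩
      obtain ⟨r₀, h1, h2⟩ := (((himg.isOpen_compl.eventually_mem h0).filter_mono
        nhdsWithin_le_nhds).and (eventually_mem_nhdsWithin (s := Ioi (0 : I)))).exists
      refine ⟨r₀, h2, fun t x hx => ?_⟩
      by_contra hmem
      exact h1 ⟨((r₀, t), x), ⟨hx, hmem⟩, rfl⟩
    let ρ : I × I → I × I := fun a => (Icc.convexComb 1 r₀ a.1, a.2)
    have hρ : Continuous ρ := (Icc.continuous_convexComb_prod.comp (by fun_prop :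
          Continuous fun a : I × I => ((1 : I), r₀, a.1))).prodMk continuous_snd
    have hρ0 : ∀ a, (ρ a).1 ≠ 0 := by
      intro a h
      have h1 := congrArg Subtype.val h
      simp only [ρ, Icc.coe_convexComb, Icc.coe_one, Icc.coe_zero] at h1
      have h2 : (0 : ℝ) < r₀ := hr₀
      have h3 := a.1.2.1
      have h4 := a.1.2.2
      rcases h3.eq_or_lt with h5 | h5
      · rw [← h5] at h1; linarith
      · nlinarith [mul_pos h5 h2]
    obtain ⟨X, hX⟩ := exists_continuous_solution
      (P := fun a : (I × I) × S => F.transport i ((ρ a.1).1, (ρ a.1).2, a.2))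
      (Q := fun a : I × I => ψ (polar (ρ a)))
      (hP.comp ((hρ.comp continuous_fst).prodMk continuous_snd)) (hΨ.comp hρ)
      (fun a => huniq (ρ a) (hρ0 a))
    have hX' : ∀ a, F.transport i ((ρ a).1, (ρ a).2, X a) = ψ (polar (ρ a)) :=
      fun a => (hX a _).2 rfl
    have htw : ∀ r, V.twist (X (r, 1)) = X (r, 0) := by
      intro r
      rw [← hX (r, 0)]
      simp only [ρ]
      rw [← F.transport_monodromy, ← hmono]
      exact hX' (r, 1)
    let p : C(I, S) := ⟨fun t => X (1, t), by fun_prop⟩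
    have h1 : TwistHomotopic V.twist β p := by
      refine .of_square X htw (fun t => ((hX (0, t) _).1 ?_).symm) fun t => rfl
      simp [ρ, hβ, polar_one]
    -- On the circle of radius `r₀` the loop is read in annulus coordinates. Its angle lifts to `ℝ`,
    -- and the twisting condition makes the defect of the lift an integer `m`.
    obtain ⟨c, hc⟩ := exists_continuous_solution (X := I) (Y := Circle × I)
      (P := fun a : I × (Circle × I) => V.annulus a.2) (Q := p)
      (V.annulus_continuous.comp continuous_snd) p.continuous (by
        intro t
        obtain ⟨a, -, ha⟩ := hin t (p t) (by simpa [ρ] using! hX' (1, t))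
        exact ⟨a, ha, fun a' ha' => V.annulus_injective (ha'.trans ha.symm)⟩)
    have hc' : ∀ t, V.annulus (c t) = p t := fun t => (hc t _).2 rfl
    have : ContractibleSpace I := (convex_Icc (0 : ℝ) 1).contractibleSpace ⟨0, by simp⟩
    have : LocallyPathConnectedSpace I := (convex_Icc (0 : ℝ) 1).locallyPathConnectedSpace
    obtain ⟨a₀, ha₀⟩ := exists_circ_eq (c 0).1
    obtain ⟨θ, -, hθ⟩ := exists_lift_circ ⟨fun t => (c t).1, by fun_prop⟩ (0 : I) ha₀
    simp only [ContinuousMap.coe_mk] at hθ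
    have hp : ∀ t, p t = V.annulus (circ (θ t), (c t).2) := fun t => by rw [hθ, ← hc' t]
    have h2 : V.annulus (circ (θ 1) * circ (c 1).2, (c 1).2) = V.annulus (circ (θ 0), (c 0).2) := by
      rw [← V.twist_annulus, ← hp, ← hp]
      exact htw 1
    have h3 := V.annulus_injective h2
    have h4 : (c 1).2 = (c 0).2 := (Prod.ext_iff.1 h3).2
    have h5 : circ (θ 1 + (c 0).2) = circ (θ 0) := by
      rw [circ_add, ← h4]
      exact (Prod.ext_iff.1 h3).1
    obtain ⟨m, hm⟩ := circ_eq_circ_iff.1 h5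
    refine ⟨m, h1.trans ?_, fun h => absurd hcrit h⟩
    exact V.twistHomotopic_wind (v := fun t => (c t).2) θ.continuous (by fun_prop) hp h4
      (by linarith)
  -- Off the critical point the position in `S` is unique down to `r = 0`, so the loop on the
  -- boundary can be contracted all the way to the centre.
  · obtain ⟨X, hX⟩ := exists_continuous_solution
      (P := fun a : (I × I) × S => F.transport i (a.1.1, a.1.2, a.2))
      (Q := fun a : I × I => ψ (polar a)) hP hΨ (by
        rintro ⟨r, t⟩
        rcases eq_or_ne r 0 with rfl | hr
        · simp only [polar_zero]
          exact F.transport_zero_unique i t hcrit (hψπ 0 (by simp))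
        · exact huniq (r, t) hr)
    have hX' : ∀ a : I × I, F.transport i (a.1, a.2, X a) = ψ (polar a) := fun a => (hX a _).2 rfl
    let p : C(I, S) := ⟨fun t => X (0, t), by fun_prop⟩
    obtain ⟨m, hm, hpm⟩ := F.exists_const_of_transport_zero i (p := p) hcrit fun t => by
      simpa [p, polar_zero] using hX' (0, t)
    refine ⟨m,
      TwistHomotopic.trans (.symm (.of_square X (fun r => ?_) (fun t => rfl) fun t => ?_)) hpm,
      fun _ => hm⟩
    · rw [← hX (r, 0)]
      simp only
      rw [← F.transport_monodromy, ← hmono]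
      exact hX' (r, 1)
    · refine ((hX (1, t) _).1 ?_).symm
      simp [hβ, polar_one]

end Factorization

/-! ### The boundary loop, via the infinite cyclic covering -/

namespace Factorization

variable {E : Type*} [TopologicalSpace E] [ChartedSpace (EuclideanHalfSpace 4) E]
  {π : E → ℂ} {S : Type*} [TopologicalSpace S] {b : S} {k : ℕ} (F : Factorization π S b k)

/-- The infinite cyclic covering of the boundary of the total space. -/
def boundaryCover (p : ℝ × S) : E :=
  F.triv (0, ⟨Int.fract p.1, Int.fract_nonneg _, (Int.fract_lt_one _).le⟩,
    (F.monodromy ^ ⌊p.1⌋ : S ≃ₜ S) p.2)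

/-- The formula persists at the right end `n + 1`, where the floor jumps, because the trivialization
at `t = 1` is the one at `t = 0` precomposed with the monodromy. Continuity follows by gluing closed
intervals. -/
theorem boundaryCover_of_mem {n : ℤ} {a : ℝ} (ha : a ∈ Icc (n : ℝ) (n + 1)) (x : S) :
    F.boundaryCover (a, x) =
      F.triv (0, projIcc 0 1 zero_le_one (a - n), (F.monodromy ^ n : S ≃ₜ S) x) := by
  rcases ha.2.eq_or_lt with h | h
  · have h1 : ⌊a⌋ = n + 1 := by rw [h]; exact_mod_cast Int.floor_intCast (n + 1)
    have h2 : projIcc (0 : ℝ) 1 zero_le_one (a - n) = 1 := projIcc_of_right_le _ (by linarith)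
    have h3 : (⟨Int.fract a, Int.fract_nonneg _, (Int.fract_lt_one _).le⟩ : I) = 0 := by
      ext
      simp only [Int.fract, h1, Icc.coe_zero]
      push_cast
      linarith
    rw [boundaryCover]
    simp only
    rw [h2, h3, h1, F.triv_left, F.triv_right, add_comm, zpow_one_add]
    rfl
  · have h1 : ⌊a⌋ = n := Int.floor_eq_iff.2 ⟨ha.1, h⟩
    have h2 : (⟨Int.fract a, Int.fract_nonneg _, (Int.fract_lt_one _).le⟩ : I) =
        projIcc 0 1 zero_le_one (a - n) := by
      rw [projIcc_of_mem zero_le_one (⟨by linarith [ha.1], by linarith⟩ : a - n ∈ Icc (0 : ℝ) 1)]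
      ext
      simp [Int.fract, h1]
    rw [boundaryCover]
    simp only
    rw [h2, h1]

theorem continuous_boundaryCover : Continuous F.boundaryCover := by
  have hn : ∀ n : ℤ, ContinuousOn F.boundaryCover (Icc (n : ℝ) (n + 1) ×ˢ univ) := by
    intro n
    have : Continuous fun p : ℝ × S =>
        F.triv (0, projIcc 0 1 zero_le_one (p.1 - n), (F.monodromy ^ n : S ≃ₜ S) p.2) :=
      F.triv_continuous.comp (continuous_const.prodMk ((continuous_projIcc.comp
        (by fun_prop)).prodMk ((F.monodromy ^ n : S ≃ₜ S).continuous.comp continuous_snd)))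
    exact this.continuousOn.congr fun p hp => F.boundaryCover_of_mem hp.1 p.2
  rw [continuous_iff_continuousAt]
  rintro ⟨a, x⟩
  have hcl : ∀ n : ℤ, IsClosed (Icc (n : ℝ) (n + 1) ×ˢ (univ : Set S)) :=
    fun n => isClosed_Icc.prod isClosed_univ
  have h := (hn (⌊a⌋ - 1)).union_of_isClosed (hn ⌊a⌋) (hcl _) (hcl _)
  refine h.continuousAt (mem_of_superset (prod_mem_nhds (Ioo_mem_nhds (a := (⌊a⌋ : ℝ) - 1)
    (b := ⌊a⌋ + 1) (by linarith [Int.floor_le a]) (Int.lt_floor_add_one a)) univ_mem) ?_)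
  rintro ⟨a', x'⟩ ⟨ha', -⟩
  rcases le_total a' ⌊a⌋ with h | h
  · refine Or.inl ⟨⟨?_, ?_⟩, mem_univ _⟩
    · push_cast; exact ha'.1.le
    · push_cast; linarith
  · exact Or.inr ⟨⟨h, ha'.2.le⟩, mem_univ _⟩

theorem boundaryCover_unique {a : ℝ} {y : E} (hy : π y = circ a) :
    ∃! x, F.boundaryCover (a, x) = y := by
  set t : I := ⟨Int.fract a, Int.fract_nonneg _, (Int.fract_lt_one _).le⟩
  have ht : circ t = circ a := circ_eq_circ_iff.2 ⟨-⌊a⌋, by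
    rw [Int.cast_neg, ← sub_eq_add_neg, Int.self_sub_floor]⟩
  obtain ⟨x, hx⟩ := F.triv_surj 0 t y (by rw [F.square_boundary, ht, hy])
  refine ⟨(F.monodromy ^ ⌊a⌋ : S ≃ₜ S).symm x, ?_, fun x' hx' => ?_⟩
  · simp only [boundaryCover, Homeomorph.apply_symm_apply]
    exact hx
  · rw [Homeomorph.eq_symm_apply]
    exact F.triv_inj 0 t (hx'.trans hx.symm)

variable [CompactSpace S] [T2Space E]

/-- A section over the boundary that represents `([α], 1)` is, in the trivialization over the cut
open circle, a loop homotopic to `α`. -/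
theorem exists_boundary_path (hπ : Continuous π) {s : Circle → E} (hs : ∀ z, π (s z) = z)
    {α : Path b b} (hα : F.Represents s α) :
    ∃ x : Path b b, (∀ t, F.triv (0, t, x t) = s (circ t)) ∧ x.Homotopic α := by
  obtain ⟨p, hp, ⟨H⟩⟩ := hα
  let Φ : C(I × I, E) := ⟨fun a => (F.boundaryIso (H a) : E),
    continuous_subtype_val.comp (F.boundaryIso.continuous.comp H.continuous)⟩
  have hΦ0 : ∀ t, Φ (0, t) = s (circ t) := fun t => by
    rw [← hp]
    simp [Φ]
  have hmk : ∀ x t, (F.boundaryIso (MappingTorus.mk F.monodromy x t) : E) = F.triv (0, t, x) :=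
    F.boundaryIso_mk
  have hΦs : ∀ r, Φ (r, 0) = F.fibre b := fun r => by
    change (F.boundaryIso (H (r, 0)) : E) = _
    rw [H.source, hmk, F.triv_left]
  have hΦt : ∀ r, Φ (r, 1) = F.fibre b := fun r => by
    change (F.boundaryIso (H (r, 1)) : E) = _
    rw [H.target, hmk, F.triv_left]
  have hΦ1 : ∀ t, Φ (1, t) = if (t : ℝ) ≤ 1 / 2 then F.fibre (α (projIcc 0 1 zero_le_one (2 * t)))
      else F.triv (0, projIcc 0 1 zero_le_one (2 * t - 1), b) := fun t => by
    change (F.boundaryIso (H (1, t)) : E) = _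
    have h1 : H (1, t) = MappingTorus.loopOne (F.twists_base k) α t := H.map_one_left t
    rw [h1, MappingTorus.loopOne, Path.trans_apply]
    split_ifs with h
    · rw [projIcc_of_mem zero_le_one
        (⟨by linarith [t.2.1], by linarith⟩ : 2 * (t : ℝ) ∈ Icc (0 : ℝ) 1)]
      exact (hmk _ _).trans (F.triv_left _ _)
    · rw [projIcc_of_mem zero_le_one (⟨by linarith, by linarith [t.2.2]⟩ :
        2 * (t : ℝ) - 1 ∈ Icc (0 : ℝ) 1)]
      exact hmk _ _
  have hnorm : ∀ a, ‖π (Φ a)‖ = 1 := fun a => (F.boundaryIso (H a)).2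
  have hmem : ∀ a, π (Φ a) ∈ Submonoid.unitSphere ℂ := fun a => by
    simpa [Submonoid.unitSphere] using hnorm a
  let u : C(I × I, Circle) := ⟨fun a => ⟨π (Φ a), hmem a⟩,
    (hπ.comp Φ.continuous).subtype_mk hmem⟩
  have hu : ∀ a, (u a : ℂ) = π (Φ a) := fun a => rfl
  have hfib : ∀ x, π (F.fibre x) = 1 := fun x => by
    rw [← F.triv_left 0, F.triv_proj, F.square_boundary]
    simp [Curve.circ_zero]
  have : ContractibleSpace I := (convex_Icc (0 : ℝ) 1).contractibleSpace ⟨0, by simp⟩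
  have : LocallyPathConnectedSpace I := (convex_Icc (0 : ℝ) 1).locallyPathConnectedSpace
  -- The angle of the homotopy lifts to `ℝ`. Uniqueness of lifts then fixes `θ` on all four sides;
  -- on the side of `loopOne` it rests at `0` while `α` runs, and then goes once around.
  obtain ⟨θ, hθ0, hθ⟩ := exists_lift_circ u ((0, 0) : I × I) (a := 0) (by
    ext
    rw [hu, hΦs, hfib]
    simp [Curve.circ_zero])
  have hθπ : ∀ a, π (Φ a) = circ (θ a) := fun a => by rw [hθ, hu]
  have hθs : ∀ r, θ (r, 0) = 0 := by
    intro r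
    refine congrFun (lift_circ_unique (θ := fun r : I => θ (r, 0)) (η := fun _ => 0) (by fun_prop)
      continuous_const (fun r => ?_) (z := 0) hθ0) r
    ext
    rw [← hθπ, hΦs, hfib]
    simp [Curve.circ_zero]
  have hθ0t : ∀ t : I, θ (0, t) = t := by
    intro t
    refine congrFun (lift_circ_unique (θ := fun t : I => θ (0, t)) (η := fun t => t) (by fun_prop)
      (by fun_prop) (fun t => ?_) (z := 0) (by simp [hθ0])) t
    ext
    rw [← hθπ, hΦ0, hs]
  have hθt : ∀ r, θ (r, 1) = 1 := by
    intro r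
    refine congrFun (lift_circ_unique (θ := fun r : I => θ (r, 1)) (η := fun _ => 1) (by fun_prop)
      continuous_const (fun r => ?_) (z := 0) (by simp [hθ0t])) r
    ext
    rw [← hθπ, hΦt, hfib]
    simp [Curve.circ_one]
  have hθ1t : ∀ t : I, θ (1, t) = projIcc (0 : ℝ) 1 zero_le_one (2 * t - 1) := by
    intro t
    refine congrFun (lift_circ_unique (θ := fun t : I => θ (1, t))
      (η := fun t => projIcc (0 : ℝ) 1 zero_le_one (2 * t - 1)) (by fun_prop)
      (continuous_subtype_val.comp (continuous_projIcc.comp (by fun_prop))) (fun t => ?_) (z := 0)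
      (by rw [hθs, projIcc_of_le_left _ (by simp)])) t
    ext
    rw [← hθπ, hΦ1]
    split_ifs with h
    · rw [hfib, projIcc_of_le_left _ (by linarith)]
      simp [Curve.circ_zero]
    · rw [F.triv_proj, F.square_boundary]
  -- Once the angle is lifted, the covering determines the component in `S`. This component is a
  -- homotopy from `x` to `α` followed by a constant loop.
  obtain ⟨X, hX⟩ := exists_continuous_solution
    (P := fun a : (I × I) × S => F.boundaryCover (θ a.1, a.2)) (Q := Φ)
    (F.continuous_boundaryCover.comp (by fun_prop)) Φ.continuous
    (fun a => F.boundaryCover_unique (hθπ a))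
  have hcover : ∀ (t : I) x, F.boundaryCover (t, x) = F.triv (0, t, x) := by
    intro t x
    rw [F.boundaryCover_of_mem (n := 0) (by simp)]
    simp
  have hXs : ∀ r, X (r, 0) = b := fun r => ((hX (r, 0) b).1 (by
    rw [hθs, hΦs]
    simpa only [F.triv_left, Icc.coe_zero] using hcover 0 b)).symm
  have hXt : ∀ r, X (r, 1) = b := fun r => ((hX (r, 1) b).1 (by
    rw [hθt, hΦt]
    have h1 := hcover 1 b
    rw [F.triv_right] at h1
    rw [show (1 : ℝ) = ((1 : I) : ℝ) by simp, h1]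
    exact congrArg F.fibre (F.twists_base k))).symm
  let x : Path b b := ⟨⟨fun t => X (0, t), by fun_prop⟩, hXs 0, hXt 0⟩
  refine ⟨x, fun t => ?_, ?_⟩
  · rw [← hΦ0, ← hcover, ← (hX (0, t) (x t)).2 rfl, hθ0t]
  · have h1 : x.Homotopic (α.trans (Path.refl b)) := by
      refine ⟨⟨⟨X, fun t => rfl, fun t => ?_⟩, ?_⟩⟩
      · refine ((hX (1, t) _).1 ?_).symm
        rw [hθ1t, hcover, hΦ1]
        simp only [Path.coe_toContinuousMap, Path.trans_apply]
        split_ifs with h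
        · have h2 : projIcc (0 : ℝ) 1 zero_le_one (2 * (t : ℝ) - 1) = 0 :=
            projIcc_of_le_left _ (by linarith)
          rw [h2, F.triv_left, projIcc_of_mem]
        · rfl
      · rintro r t (rfl | rfl)
        · exact (hXs r).trans (hXs 0).symm
        · exact (hXt r).trans (hXt 0).symm
    exact h1.trans (Path.Homotopic.trans_refl _)

end Factorization

/-! ### Concatenation of loops at constant speed -/

section Concatenation

variable {S : Type*} [TopologicalSpace S] {b : S}

theorem concatLoops_succ {n : ℕ} (γ : Fin (n + 1) → Path b b) :
    concatLoops γ = (γ 0).trans (concatLoops fun i => γ i.succ) := by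
  simp [concatLoops, List.ofFn_succ]

/-- Arbitrary breakpoints make the induction possible: after the first piece is split off, what
remains starts at `t 1`. The splitting is a homotopy because paths in `I` with common ends are
homotopic. -/
theorem homotopic_concatLoops_aux (Q : C(I, S)) (n : ℕ) (γ : Fin n → Path b b) (t : ℕ → I)
    (h : ∀ (i : Fin n) (a : I), Q (Icc.convexComb (t i) (t (i + 1)) a) = γ i a) (R : Path b b)
    (hR : ∀ a, R a = Q (Icc.convexComb (t 0) (t n) a)) : R.Homotopic (concatLoops γ) := by
  induction n generalizing t R with
  | zero =>
    have h1 : R = Path.refl b := by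
      ext a
      have h2 := hR 0
      rw [Icc.convexComb_eq, R.source] at h2
      rw [hR, Icc.convexComb_eq, ← h2, Path.refl_apply]
    rw [h1]
    exact .refl _
  | succ n ih =>
    have hcont : ∀ x y : I, Continuous fun a : I => Icc.convexComb x y a := fun x y =>
      Icc.continuous_convexComb_prod.comp (by fun_prop : Continuous fun a : I => (x, y, a))
    let R' : Path b b := ⟨⟨fun a => Q (Icc.convexComb (t 1) (t (n + 1)) a),
        Q.continuous.comp (hcont _ _)⟩, by
          have := h 0 1
          simpa using this, by
          have := hR 1
          simpa using this.symm⟩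
    rw [concatLoops_succ]
    refine Path.Homotopic.trans (p₁ := (γ 0).trans R') ?_ (Path.Homotopic.hcomp (.refl _)
      (ih (fun i => γ i.succ) (fun j => t (j + 1)) (fun i a => h i.succ a) R' fun a => rfl))
    let C : (x y : I) → Path x y := fun x y =>
      ⟨⟨fun a => Icc.convexComb x y a, hcont x y⟩, by simp, by simp⟩
    have : ContractibleSpace I := (convex_Icc (0 : ℝ) 1).contractibleSpace ⟨0, by simp⟩
    refine homotopic_of_factor Q.continuous (C (t 0) (t (n + 1)))
      ((C (t 0) (t 1)).trans (C (t 1) (t (n + 1)))) hR fun a => ?_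
    simp only [Path.trans_apply]
    split_ifs
    · exact (h 0 _).symm
    · rfl

/-- A path whose pieces over `[i / k, (i + 1) / k]` are the loops `γ i` is homotopic to their
concatenation. -/
theorem homotopic_concatLoops {k : ℕ} (hk : k ≠ 0) (Q : Path b b) (γ : Fin k → Path b b)
    (h : ∀ (i : Fin k) (t u : I), (u : ℝ) * k = (i : ℕ) + (t : ℝ) → Q u = γ i t) :
    Q.Homotopic (concatLoops γ) := by
  have hk' : (0 : ℝ) < k := by exact_mod_cast Nat.pos_of_ne_zero hk
  let t : ℕ → I := fun i => projIcc 0 1 zero_le_one ((i : ℝ) / k)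
  have ht : ∀ i ≤ k, (t i : ℝ) = i / k := by
    intro i hi
    have h1 : (i : ℝ) ≤ k := by exact_mod_cast hi
    simp only [t]
    rw [projIcc_of_mem zero_le_one
      (⟨by positivity, (div_le_one hk').2 h1⟩ : (i : ℝ) / k ∈ Icc (0 : ℝ) 1)]
  have ht0 : t 0 = 0 := Subtype.ext (by rw [ht 0 (Nat.zero_le _)]; simp)
  have htk : t k = 1 := Subtype.ext (by rw [ht k le_rfl]; simp [hk'.ne'])
  refine homotopic_concatLoops_aux (Q : C(I, S)) k γ t (fun i a => h i a _ ?_) Q fun a => ?_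
  · rw [Icc.coe_convexComb, ht i i.2.le, ht (i + 1) i.2]
    field_simp
    push_cast
    ring
  · rw [ht0, htk, Icc.convexComb_zero_one]
    rfl

theorem exists_fin_add_eq {k : ℕ} (hk : k ≠ 0) (u : I) :
    ∃ (i : Fin k) (t : I), (u : ℝ) * k = (i : ℕ) + (t : ℝ) := by
  have hk' : (0 : ℝ) < k := by exact_mod_cast Nat.pos_of_ne_zero hk
  have h0 : 0 ≤ (u : ℝ) * k := mul_nonneg u.2.1 hk'.le
  -- At `u = 1` the floor would give the index `k`, so the end of the last piece is used instead.
  rcases u.2.2.eq_or_lt with h | h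
  · refine ⟨⟨k - 1, by omega⟩, 1, ?_⟩
    have : ((k - 1 : ℕ) : ℝ) = k - 1 := by
      rw [Nat.cast_sub (by omega)]; simp
    simp only [this, h, Icc.coe_one]
    ring
  · have h1 : ⌊(u : ℝ) * k⌋₊ < k := by
      rw [Nat.floor_lt h0]
      nlinarith
    refine ⟨⟨_, h1⟩, ⟨(u : ℝ) * k - ⌊(u : ℝ) * k⌋₊, ?_, ?_⟩, by simp⟩
    · linarith [Nat.floor_le h0]
    · linarith [Nat.lt_floor_add_one ((u : ℝ) * k)]

/-- Loops can be concatenated at constant speed. -/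
theorem exists_uniform_concat {k : ℕ} (hk : k ≠ 0) (γ : Fin k → Path b b) :
    ∃ Q : Path b b,
      ∀ (i : Fin k) (t u : I), (u : ℝ) * k = (i : ℕ) + (t : ℝ) → Q u = γ i t := by
  have hk' : (0 : ℝ) < k := by exact_mod_cast Nat.pos_of_ne_zero hk
  let q : (Σ _ : Fin k, I) → I := fun a => ⟨((a.1 : ℕ) + (a.2 : ℝ)) / k, by
    have h1 : ((a.1 : ℕ) : ℝ) + 1 ≤ k := by exact_mod_cast a.1.2
    have h2 := a.2.2.1
    have h3 := a.2.2.2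
    exact ⟨by positivity, (div_le_one hk').2 (by linarith)⟩⟩
  have hq : Continuous q := continuous_sigma fun i => by
    refine Continuous.subtype_mk ?_ _
    fun_prop
  have hf : Continuous fun a : (Σ _ : Fin k, I) => γ a.1 a.2 :=
    continuous_sigma fun i => (γ i).continuous
  have : Nonempty S := ⟨b⟩
  -- Different pieces overlap only where one ends and another starts, and there both loops are at
  -- `b`.
  have hnext : ∀ (i j : Fin k) (t t' : I), ((i : ℕ) : ℝ) + t = (j : ℕ) + t' → i < j →
      t = 1 ∧ t' = 0 := by
    intro i j t t' h hij
    have h1 : ((i : ℕ) : ℝ) + 1 ≤ (j : ℕ) := by exact_mod_cast hij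
    have h2 := t.2.2
    have h3 := t'.2.1
    exact ⟨Subtype.ext (by rw [Icc.coe_one]; linarith),
      Subtype.ext (by rw [Icc.coe_zero]; linarith)⟩
  obtain ⟨Q, hQ, hQγ⟩ := exists_continuousOn_descend hq hf (by
    rintro ⟨i, t⟩ ⟨j, t'⟩ h
    have h1 : ((i : ℕ) : ℝ) + t = (j : ℕ) + t' := by
      have := congrArg Subtype.val h
      simpa [q, div_left_inj' hk'.ne'] using this
    rcases lt_trichotomy i j with hij | rfl | hij
    · obtain ⟨rfl, rfl⟩ := hnext i j t t' h1 hij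
      simp
    · have : t = t' := Subtype.ext (by linarith)
      rw [this]
    · obtain ⟨rfl, rfl⟩ := hnext j i t' t h1.symm hij
      simp)
  have hQ' : ∀ (i : Fin k) (t u : I), (u : ℝ) * k = (i : ℕ) + (t : ℝ) → Q u = γ i t := by
    intro i t u h
    rw [← hQγ ⟨i, t⟩]
    congr 1
    ext
    simp only [q, ← h]
    field_simp
  have hrange : range q = univ := by
    refine eq_univ_of_forall fun u => ?_
    obtain ⟨i, t, h⟩ := exists_fin_add_eq hk u
    refine ⟨⟨i, t⟩, Subtype.ext ?_⟩
    simp only [q, ← h]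
    field_simp
  rw [hrange, continuousOn_univ] at hQ
  refine ⟨⟨⟨Q, hQ⟩, ?_, ?_⟩, hQ'⟩
  · have := hQ' ⟨0, Nat.pos_of_ne_zero hk⟩ 0 0 (by simp)
    simpa using this
  · obtain ⟨i, t, h⟩ := exists_fin_add_eq hk 1
    have h1 : t = 1 := by
      have h2 : ((i : ℕ) : ℝ) + 1 ≤ k := by exact_mod_cast i.2
      have h3 := t.2.2
      rw [Icc.coe_one, one_mul] at h
      exact Subtype.ext (by rw [Icc.coe_one]; linarith)
    subst h1
    simpa using hQ' i 1 1 h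

end Concatenation

/-! ### From a section to a decomposition -/

namespace Factorization

variable {E : Type*} [TopologicalSpace E] [ChartedSpace (EuclideanHalfSpace 4) E]
  {π : E → ℂ} {S : Type*} [TopologicalSpace S] {b : S} {k : ℕ} (F : Factorization π S b k)

theorem proj_fibre (x : S) : π (F.fibre x) = 1 := by
  rw [← F.triv_left 0, F.triv_proj, F.square_boundary]
  simp [Curve.circ_zero]

theorem square_left (r : I) : F.square (r, 0) = 1 := by
  rw [← F.triv_proj r 0 b, F.triv_left, F.proj_fibre]

theorem square_right (r : I) : F.square (r, 1) = 1 := by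
  rw [← F.triv_proj r 1 b, F.triv_right, F.proj_fibre]

theorem square_one {i : Fin k} {t u : I} (h : (u : ℝ) * k = (i : ℕ) + (t : ℝ)) :
    F.square (1, u) = F.disk i (circ t) := by
  rw [← F.triv_proj 1 u b, F.triv_disks i t u b h, F.proj_transport, polar_one]

theorem continuous_square (hπ : Continuous π) : Continuous F.square :=
  (hπ.comp (F.triv_continuous.comp (by fun_prop :
    Continuous fun a : I × I => (a.1, a.2, b)))).congr fun a => F.triv_proj a.1 a.2 b

theorem disk_mem (i : Fin k) {w : ℂ} (hw : w ∈ closedBall (0 : ℂ) 1) :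
    F.disk i w ∈ closedBall (0 : ℂ) 1 := by
  rw [mem_closedBall_zero_iff]
  by_cases h : w = 1
  · rw [h, F.disk_one]; simp
  · exact (F.disk_interior i w hw h).le

theorem circ_mem (t : ℝ) : (circ t : ℂ) ∈ closedBall (0 : ℂ) 1 := by
  rw [mem_closedBall_zero_iff, Circle.norm_coe]

theorem transport_one_unique (i : Fin k) {t : I} {y : E} (hy : π y = F.disk i (circ t)) :
    ∃! x, F.transport i (1, t, x) = y := by
  obtain ⟨x, hx⟩ := F.transport_surj i 1 t y (by simpa using hy)
  exact ⟨x, hx, fun x' hx' => F.transport_inj i 1 t one_ne_zero (hx'.trans hx.symm)⟩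

variable [CompactSpace S] [T2Space S] [PathConnectedSpace S] [T2Space E]

/-- A section over the disk gives a decomposition of the boundary loop; the exponents are `0` or
`1` where the section, or a section homotopic to it, avoids the critical points. -/
theorem decomposes_of_sectionHomotopic (hπ : Continuous π) (hD : ∀ y, ‖π y‖ ≤ 1) {s : Circle → E}
    (hs : ∀ z, π (s z) = z) {α : Path b b} (hα : F.Represents s α) {φ ψ : ℂ → E}
    (hφs : Extends φ s) (hφψ : SectionHomotopic π φ ψ) {M : Set ℤ}
    (hM : ∀ i m, (ψ (F.disk i 0) ≠ F.crit i → m ∈ ({0, 1} : Set ℤ)) → m ∈ M) :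
    F.Decomposes α M := by
  obtain ⟨x, hx, hxα⟩ := F.exists_boundary_path hπ hs hα
  obtain ⟨K, hK, hKπ, hK0, hK1⟩ := hφψ
  have hsqD : ∀ a, F.square a ∈ closedBall (0 : ℂ) 1 := fun a => by
    rw [mem_closedBall_zero_iff, ← F.triv_proj a.1 a.2 b]
    exact hD _
  have hφc : ContinuousOn φ (closedBall 0 1) := by
    have h1 : ContinuousOn (fun z : ℂ => K (0, z)) (closedBall 0 1) :=
      hK.comp (by fun_prop) fun z hz => ⟨mem_univ _, hz⟩
    exact h1.congr fun z hz => (hK0 z hz).symm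
  have hψc : ContinuousOn ψ (closedBall 0 1) := by
    have h1 : ContinuousOn (fun z : ℂ => K (1, z)) (closedBall 0 1) :=
      hK.comp (by fun_prop) fun z hz => ⟨mem_univ _, hz⟩
    exact h1.congr fun z hz => (hK1 z hz).symm
  have hφπ : ∀ z ∈ closedBall (0 : ℂ) 1, π (φ z) = z := fun z hz => by
    rw [← hK0 z hz]; exact hKπ 0 z hz
  have hψπ : ∀ z ∈ closedBall (0 : ℂ) 1, π (ψ z) = z := fun z hz => by
    rw [← hK1 z hz]; exact hKπ 1 z hz
  have hφcirc : ∀ t : ℝ, φ (circ t) = s (circ t) := fun t => hφs (circ t)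
  have hφ1 : φ 1 = F.fibre b := by
    have h1 := hx 0
    rw [x.source, F.triv_left, ← hφcirc] at h1
    simpa [Curve.circ_zero] using h1.symm
  -- the section over the square
  obtain ⟨X, hX⟩ := exists_continuous_solution
    (P := fun a : (I × I) × S => F.triv (a.1.1, a.1.2, a.2)) (Q := fun a : I × I => φ (F.square a))
    (F.triv_continuous.comp (by fun_prop))
    (hφc.comp_continuous (F.continuous_square hπ) hsqD) (by
      intro a
      obtain ⟨y, hy⟩ := F.triv_surj a.1 a.2 (φ (F.square a)) (hφπ _ (hsqD a))
      exact ⟨y, hy, fun y' hy' => F.triv_inj a.1 a.2 (hy'.trans hy.symm)⟩)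
  have hX' : ∀ r t, F.triv (r, t, X (r, t)) = φ (F.square (r, t)) := fun r t => (hX (r, t) _).2 rfl
  have hXl : ∀ r, X (r, 0) = b := fun r => ((hX (r, 0) b).1 (by
    simp only [F.triv_left, F.square_left, hφ1])).symm
  have hXr : ∀ r, X (r, 1) = b := fun r => ((hX (r, 1) b).1 (by
    simp only [F.triv_right, F.square_right, hφ1]
    exact congrArg F.fibre (F.twists_base k))).symm
  have hX0 : ∀ t, X (0, t) = x t := fun t => ((hX (0, t) (x t)).1 (by
    simp only [hx, F.square_boundary, hφcirc])).symm
  let Q : Path b b := ⟨⟨fun t => X (1, t), by fun_prop⟩, hXl 1, hXr 1⟩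
  have hxQ : x.Homotopic Q := by
    refine ⟨⟨⟨X, hX0, fun t => rfl⟩, ?_⟩⟩
    rintro r t (rfl | rfl)
    · exact (hXl r).trans x.source.symm
    · exact (hXr r).trans x.target.symm
  -- the sections over the disks
  have hdiskK : ∀ i, Continuous fun a : I × I => K (a.1, F.disk i (circ a.2)) := by
    intro i
    have h1 : Continuous fun a : I × I => F.disk i (circ a.2) :=
      (F.disk_continuousOn i).comp_continuous
        (continuous_subtype_val.comp (continuous_circ.comp (by fun_prop))) fun a => circ_mem _
    exact hK.comp_continuous (continuous_fst.prodMk h1)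
      fun a => ⟨mem_univ _, F.disk_mem i (circ_mem _)⟩
  -- The whole homotopy `K` is read over `∂D_i`. It may move the value over the base point, so it
  -- gives a twisted homotopy and not a based one; this suffices, since the exponent is obtained
  -- from twisted homotopy.
  have hY : ∀ i, ∃ Y : C(I × I, S), ∀ a y,
      F.transport i (1, a.2, y) = K (a.1, F.disk i (circ a.2)) ↔ y = Y a := fun i =>
    exists_continuous_solution (P := fun a : (I × I) × S => F.transport i (1, a.1.2, a.2))
      ((F.transport_continuous i).comp (by fun_prop)) (hdiskK i)
      fun a => F.transport_one_unique i (t := a.2) (hKπ a.1 _ (F.disk_mem i (circ_mem _)))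
  choose Y hY using hY
  have hY' : ∀ i r t, F.transport i (1, t, Y i (r, t)) = K (r, F.disk i (circ t)) :=
    fun i r t => (hY i (r, t) _).2 rfl
  have hYtw : ∀ i r, (F.V i).twist (Y i (r, 1)) = Y i (r, 0) := by
    intro i r
    rw [← hY i (r, 0)]
    simp only
    rw [← F.transport_monodromy, hY' i r 1]
    simp [Curve.circ_zero, Curve.circ_one]
  have hK01 : K (0, 1) = F.fibre b := by rw [hK0 1 (by simp), hφ1]
  have hY0 : ∀ i, Y i (0, 0) = b := fun i => ((hY i (0, 0) b).1 (by
    simp [F.transport_base, Curve.circ_zero, F.disk_one, hK01])).symm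
  have hY1 : ∀ i, Y i (0, 1) = b := fun i => by
    apply (F.V i).twist.injective
    rw [hYtw, hY0, (F.V i).twist_base]
  let β : Fin k → Path b b := fun i => ⟨⟨fun t => Y i (0, t), by fun_prop⟩, hY0 i, hY1 i⟩
  -- Along `∂D_i` the trivialization differs from the transport by the preceding twists, which is
  -- why their inverses appear in the decomposition.
  have hβQ : ∀ (i : Fin k) (t u : I), (u : ℝ) * k = (i : ℕ) + (t : ℝ) →
      Q u = pullLoop (F.twists i) (F.twists_base i) (β i) t := by
    intro i t u h
    change X (1, u) = (F.twists i).symm (Y i (0, t))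
    rw [Homeomorph.eq_symm_apply]
    refine (hY i (0, t) _).1 ?_
    simp only
    rw [hK0 _ (F.disk_mem i (circ_mem _)), ← F.square_one h, ← hX', F.triv_disks i t u _ h]
    rfl
  have hdec : ∀ i, ∃ m ∈ M, ∃ ζ : Path b b,
      (β i).Homotopic ((ζ.trans (loopPow (F.V i).basedLoop m)).trans
        (pullLoop (F.V i).twist (F.V i).twist_base ζ.symm)) := by
    intro i
    let β' : C(I, S) := ⟨fun t => Y i (1, t), by fun_prop⟩
    obtain ⟨m, hm, hm'⟩ := F.exists_twistHomotopic_of_section i (ψ := ψ ∘ F.disk i) (β := β')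
      (hψc.comp (F.disk_continuousOn i) fun w hw => F.disk_mem i hw)
      (fun w hw => hψπ _ (F.disk_mem i hw)) fun t => by
        rw [Function.comp_apply, ← hK1 _ (F.disk_mem i (circ_mem _))]
        exact hY' i 1 t
    have h1 : TwistHomotopic (F.V i).twist (β i) β' :=
      .of_square (Y i) (hYtw i) (fun t => rfl) fun t => rfl
    exact ⟨m, hM i m hm', ((F.V i).exists_conj_loopPow_iff (β i) m).2 (h1.trans hm)⟩
  choose m hm ζ hζ using hdec
  refine ⟨m, ζ, β, hm, hζ, hxα.symm.trans (hxQ.trans ?_)⟩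
  rcases eq_or_ne k 0 with rfl | hk
  · have h1 : Q = Path.refl b := by
      ext t
      refine ((hX (1, t) b).1 ?_).symm
      have h2 : F.square (1, t) = 1 := by
        rw [← F.triv_proj 1 t b, F.triv_disks_of_zero rfl, F.proj_fibre]
      simp only [F.triv_disks_of_zero rfl, h2, hφ1]
    rw [h1]
    exact .refl _
  · exact homotopic_concatLoops hk Q _ hβQ

end Factorization

/-! ### From a decomposition to a section -/

namespace Factorization

variable {E : Type*} [TopologicalSpace E] [ChartedSpace (EuclideanHalfSpace 4) E]
  {π : E → ℂ} {S : Type*} [TopologicalSpace S] {b : S} {k : ℕ} (F : Factorization π S b k)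

theorem disk_eq_one_iff (i : Fin k) {w : ℂ} (hw : w ∈ closedBall (0 : ℂ) 1) :
    F.disk i w = 1 ↔ w = 1 := by
  refine ⟨fun h => F.disk_injOn i hw (by simp) (h.trans (F.disk_one i).symm), ?_⟩
  rintro rfl
  exact F.disk_one i

/-- A point of the square that lies on one of the disks but is not the base point lies on the
boundary of that disk. -/
theorem exists_of_square_eq_disk {r u : I} {i : Fin k} {w : ℂ} (hw : w ∈ closedBall (0 : ℂ) 1)
    (h : F.square (r, u) = F.disk i w) (h1 : F.square (r, u) ≠ 1) :
    r = 1 ∧ ∃ t : I, (u : ℝ) * k = (i : ℕ) + (t : ℝ) ∧ w = circ t := by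
  have hu0 : u ≠ 0 := by rintro rfl; exact h1 (F.square_left r)
  have hu1 : u ≠ 1 := by rintro rfl; exact h1 (F.square_right r)
  obtain rfl : r = 1 := by
    by_contra hr
    exact F.square_disk r u hr hu0 hu1 i ⟨w, hw, h.symm⟩
  obtain ⟨j, t, hjt⟩ := exists_fin_add_eq (Fin.pos i).ne' u
  rw [F.square_one hjt] at h h1
  obtain rfl : j = i := by
    by_contra hji
    have h2 := (F.disk_disjoint j i hji _ (circ_mem t) w hw h).1
    exact h1 ((F.disk_eq_one_iff j (circ_mem t)).2 h2)
  exact ⟨rfl, t, hjt, (F.disk_injOn j (circ_mem t) hw h).symm⟩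

variable [CompactSpace S] [T2Space E]

/-- A decomposition of the boundary loop gives a section over the disk, which avoids the critical
points if all exponents are `0` or `1`. -/
theorem exists_section_of_decomposes (hπ : Continuous π) (hD : ∀ y, ‖π y‖ ≤ 1) {s : Circle → E}
    (hs : ∀ z, π (s z) = z) {α : Path b b} (hα : F.Represents s α) {M : Set ℤ}
    (hM : F.Decomposes α M) :
    ∃ φ : ℂ → E, IsContinuousSection π φ ∧ Extends φ s ∧
      (M ⊆ {0, 1} → ∀ z ∈ closedBall (0 : ℂ) 1, ¬ IsCritical π (φ z)) := by
  obtain ⟨x, hx, hxα⟩ := F.exists_boundary_path hπ hs hα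
  obtain ⟨m, ζ, β, hm, hβ, hαβ⟩ := hM
  have hψ := fun i => F.exists_section_of_twistHomotopic i
    (((F.V i).exists_conj_loopPow_iff (β i) (m i)).1 ⟨ζ i, hβ i⟩)
  choose ψ hψc hψπ hψβ hψ0 using hψ
  have hψ1 : ∀ i, ψ i 1 = F.fibre b := fun i => by
    have h1 := hψβ i 0
    simpa [Curve.circ_zero, F.transport_base] using h1
  obtain ⟨Q, hQ, hQ0, hQα⟩ : ∃ Q : Path b b,
      (∀ (i : Fin k) (t u : I), (u : ℝ) * k = (i : ℕ) + (t : ℝ) →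
        Q u = pullLoop (F.twists i) (F.twists_base i) (β i) t) ∧
      (k = 0 → ∀ u, Q u = b) ∧ α.Homotopic Q := by
    rcases eq_or_ne k 0 with rfl | hk
    · exact ⟨Path.refl b, fun i => i.elim0, fun _ _ => rfl, hαβ⟩
    · obtain ⟨Q, hQ⟩ := exists_uniform_concat hk
        fun i => pullLoop (F.twists i) (F.twists_base i) (β i)
      exact ⟨Q, hQ, fun h => absurd h hk, hαβ.trans (homotopic_concatLoops hk Q _ hQ).symm⟩
  obtain ⟨H⟩ := hxα.trans hQα
  have hH0 : ∀ t, H (0, t) = x t := H.apply_zero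
  have hH1 : ∀ t, H (1, t) = Q t := H.apply_one
  have hHl : ∀ r, H (r, 0) = b := H.source
  have hHr : ∀ r, H (r, 1) = b := H.target
  have hsqD : ∀ a, F.square a ∈ closedBall (0 : ℂ) 1 := fun a => by
    rw [mem_closedBall_zero_iff, ← F.triv_proj a.1 a.2 b]
    exact hD _
  have hseam : ∀ (i : Fin k) (t u : I), (u : ℝ) * k = (i : ℕ) + (t : ℝ) →
      F.triv (1, u, H (1, u)) = ψ i (circ t) := by
    intro i t u h
    rw [F.triv_disks i t u _ h, hψβ, hH1, hQ i t u h]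
    congr 3
    exact (F.twists i).apply_symm_apply (β i t)
  -- Several points of the square lie over the base point; the section takes the value `F.fibre b`
  -- at all of them.
  have hbase : ∀ r u, F.square (r, u) = 1 → F.triv (r, u, H (r, u)) = F.fibre b := by
    intro r u h
    rcases F.square_eq_one r u h with rfl | rfl | rfl
    · rcases eq_or_ne k 0 with hk | hk
      · rw [F.triv_disks_of_zero hk, hH1, hQ0 hk]
      · obtain ⟨j, t, hjt⟩ := exists_fin_add_eq hk u
        rw [F.square_one hjt, F.disk_eq_one_iff j (circ_mem t)] at h
        rw [hseam j t u hjt, h, hψ1]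
    · rw [F.triv_left, hHl]
    · rw [F.triv_right, hHr]
      exact congrArg F.fibre (F.twists_base k)
  have hglue : ∀ r u i, ∀ w ∈ closedBall (0 : ℂ) 1, F.square (r, u) = F.disk i w →
      F.triv (r, u, H (r, u)) = ψ i w := by
    intro r u i w hw h
    by_cases h1 : F.square (r, u) = 1
    · obtain rfl := (F.disk_eq_one_iff i hw).1 (h ▸ h1)
      rw [hbase r u h1, hψ1]
    · obtain ⟨rfl, t, ht, rfl⟩ := F.exists_of_square_eq_disk hw h h1
      exact hseam i t u ht
  -- The disk `D` is a quotient of the disjoint union of the square and the `k` small disks, so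
  -- agreement on overlaps yields a continuous section.
  let q : (I × I) ⊕ (Σ _ : Fin k, closedBall (0 : ℂ) 1) → ℂ :=
    Sum.elim F.square fun a => F.disk a.1 a.2
  let f : (I × I) ⊕ (Σ _ : Fin k, closedBall (0 : ℂ) 1) → E :=
    Sum.elim (fun a => F.triv (a.1, a.2, H a)) fun a => ψ a.1 a.2
  have hqc : Continuous q := by
    refine (F.continuous_square hπ).sumElim (continuous_sigma fun i => ?_)
    exact (F.disk_continuousOn i).comp_continuous continuous_subtype_val fun w => w.2
  have hfc : Continuous f := by
    refine (F.triv_continuous.comp (by fun_prop)).sumElim (continuous_sigma fun i => ?_)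
    exact (hψc i).comp_continuous continuous_subtype_val fun w => w.2
  have hqf : ∀ a a', q a = q a' → f a = f a' := by
    rintro (⟨r, u⟩ | ⟨i, w⟩) (⟨r', u'⟩ | ⟨i', w'⟩) h
    · change F.square (r, u) = F.square (r', u') at h
      change F.triv (r, u, H (r, u)) = F.triv (r', u', H (r', u'))
      by_cases h1 : F.square (r, u) = 1
      · rw [hbase r u h1, hbase r' u' (h ▸ h1)]
      · obtain ⟨rfl, rfl⟩ := Prod.mk.inj (F.square_inj _ _ h h1)
        rfl
    · exact hglue r u i' w' w'.2 h
    · exact (hglue r' u' i w w.2 h.symm).symm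
    · change ψ i w = ψ i' w'
      by_cases hii : i = i'
      · subst hii
        rw [F.disk_injOn i w.2 w'.2 h]
      · obtain ⟨h1, h2⟩ := F.disk_disjoint i i' hii w w.2 w' w'.2 h
        rw [h1, h2, hψ1, hψ1]
  have : Nonempty E := ⟨F.fibre b⟩
  obtain ⟨φ, hφc, hφ⟩ := exists_continuousOn_descend hqc hfc hqf
  have hφsq : ∀ r u, φ (F.square (r, u)) = F.triv (r, u, H (r, u)) := fun r u => hφ (.inl (r, u))
  have hφd : ∀ i, ∀ w ∈ closedBall (0 : ℂ) 1, φ (F.disk i w) = ψ i w :=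
    fun i w hw => hφ (.inr ⟨i, w, hw⟩)
  have hcover : ∀ z ∈ closedBall (0 : ℂ) 1, z ∈ range q := by
    intro z hz
    rcases F.square_cover z hz with ⟨a, ha⟩ | ⟨i, w, hw, ha⟩
    · exact ⟨.inl a, ha⟩
    · exact ⟨.inr ⟨i, w, hw⟩, ha⟩
  have hφπ : ∀ z ∈ closedBall (0 : ℂ) 1, π (φ z) = z := by
    intro z hz
    rcases F.square_cover z hz with ⟨⟨r, u⟩, rfl⟩ | ⟨i, w, hw, rfl⟩
    · rw [hφsq, F.triv_proj]
    · rw [hφd i w hw, hψπ i w hw]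
  refine ⟨φ, ⟨hφc.mono hcover, hφπ⟩, fun z => ?_, fun hM01 z hz hcrit => ?_⟩
  · obtain ⟨t, rfl⟩ := exists_circ_eq z
    rw [← F.square_boundary, hφsq, hH0, hx]
  · obtain ⟨i, hi⟩ : φ z ∈ range F.crit := by rw [F.range_crit]; exact hcrit
    have h0 : z = F.disk i 0 := by rw [F.disk_zero, hi, hφπ z hz]
    rw [h0, hφd i 0 (by simp)] at hi
    exact hψ0 i (hM01 (hm i)) hi.symm

end Factorization

/-! ### Assembling the three equivalences -/

variable {E : Type*} [TopologicalSpace E] [ChartedSpace (EuclideanHalfSpace 4) E]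
  {π : E → ℂ} {φ ψ : ℂ → E}

theorem IsSmoothSection.isContinuousSection (h : IsSmoothSection π φ) : IsContinuousSection π φ :=
  ⟨h.1.continuousOn, h.2⟩

theorem isSmoothable_iff :
    IsSmoothable π φ ↔ ∃ ψ, IsSmoothSection π ψ ∧ SectionHomotopic π φ ψ := by
  constructor
  · rintro ⟨K, hK, hKπ, hK0, hK1⟩
    exact ⟨_, hK1, K, hK, hKπ, hK0, fun _ _ => rfl⟩
  · rintro ⟨ψ, hψ, K, hK, hKπ, hK0, hK1⟩
    exact ⟨K, hK, hKπ, hK0, hψ.1.congr hK1, hKπ 1⟩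

end Lefschetz
end

theorem mainTheorem2
    {E : Type*} [TopologicalSpace E] [ChartedSpace (EuclideanHalfSpace 4) E]
    [IsManifold (𝓡∂ 4) ∞ E] [T2Space E] [CompactSpace E] [ConnectedSpace E]
    (A : Lefschetz.OrientedAtlas E) (π : E → ℂ) (hπ : Lefschetz.IsLefschetzFibration A π)
    {S : Type*} [TopologicalSpace S] [ChartedSpace (EuclideanSpace ℝ (Fin 2)) S]
    [T2Space S] [CompactSpace S] [ConnectedSpace S]
    (b : S) (k : ℕ) (F : Lefschetz.Factorization π S b k)
    (α : Path b b) (s : C(Circle, E)) (hs : ∀ z : Circle, π (s z) = z)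
    (hα : F.Represents s α) :
    ((∃ φ : ℂ → E, Lefschetz.IsContinuousSection π φ ∧ Lefschetz.Extends φ s) ↔
      F.Decomposes α Set.univ) ∧
    ((∃ φ : ℂ → E, Lefschetz.IsContinuousSection π φ ∧ Lefschetz.Extends φ s ∧
        Lefschetz.IsSmoothable π φ) ↔
      F.Decomposes α {0, 1}) ∧
    (ContMDiff (𝓡 1) (𝓡∂ 4) ∞ s →
      ((∃ φ : ℂ → E, Lefschetz.IsSmoothSection π φ ∧ Lefschetz.Extends φ s) ↔
        F.Decomposes α {0, 1})) := by
  have : LocallyPathConnectedSpace S :=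
    ChartedSpace.locallyPathConnectedSpace (EuclideanSpace ℝ (Fin 2)) S
  have : PathConnectedSpace S := pathConnectedSpace_iff_connectedSpace.2 inferInstance
  have hπc := hπ.smooth.continuous
  -- Shared by parts 2 and 3: a smooth `ψ` misses every critical point, so all exponents can be
  -- taken in `{0, 1}`.
  have hsmooth : ∀ {φ ψ : ℂ → E}, Lefschetz.Extends φ s → Lefschetz.IsSmoothSection π ψ →
      Lefschetz.SectionHomotopic π φ ψ → F.Decomposes α {0, 1} := by
    intro φ ψ hφs hψ hφψ
    refine F.decomposes_of_sectionHomotopic hπc hπ.mem_disk hs hα hφs hφψ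
      fun i m h => h fun hcrit => ?_
    refine hψ.not_isCritical hπ (F.disk_mem i (Metric.mem_closedBall_self zero_le_one)) ?_
    rw [hcrit]
    exact F.range_crit.subset (Set.mem_range_self i)
  refine ⟨⟨?_, ?_⟩, ⟨?_, ?_⟩, fun hs' => ⟨?_, ?_⟩⟩
  · rintro ⟨φ, hφ, hφs⟩
    exact F.decomposes_of_sectionHomotopic hπc hπ.mem_disk hs hα hφs (.refl hφ)
      fun _ _ _ => Set.mem_univ _
  · intro h
    obtain ⟨φ, hφ, hφs, -⟩ := F.exists_section_of_decomposes hπc hπ.mem_disk hs hα h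
    exact ⟨φ, hφ, hφs⟩
  · rintro ⟨φ, -, hφs, hφ⟩
    obtain ⟨ψ, hψ, hφψ⟩ := Lefschetz.isSmoothable_iff.1 hφ
    exact hsmooth hφs hψ hφψ
  · intro h
    obtain ⟨φ, hφ, hφs, hcrit⟩ := F.exists_section_of_decomposes hπc hπ.mem_disk hs hα h
    -- Smoothability does not require the boundary values to be kept, so nothing is held fixed.
    obtain ⟨ψ, hψ, hφψ, -⟩ := Lefschetz.exists_isSmoothSection hπ hφ (hcrit subset_rfl)
      (T := ∅) isClosed_empty (by simp [Lefschetz.HasSmoothGerms]) (Set.empty_subset _)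
    exact ⟨φ, hφ, hφs, Lefschetz.isSmoothable_iff.2 ⟨ψ, hψ, hφψ⟩⟩
  · rintro ⟨φ, hφ, hφs⟩
    exact hsmooth hφs hφ (.refl hφ.isContinuousSection)
  · intro h
    obtain ⟨φ, hφ, hφs, hcrit⟩ := F.exists_section_of_decomposes hπc hπ.mem_disk hs hα h
    -- Here the smoothing is relative to the unit circle, where `s` is smooth, so the boundary
    -- values survive.
    obtain ⟨ψ, hψ, -, hψφ⟩ := Lefschetz.exists_isSmoothSection hπ hφ (hcrit subset_rfl)
      Metric.isClosed_sphere (Lefschetz.hasSmoothGerms_sphere hs' hφs)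
      Metric.sphere_subset_closedBall
    refine ⟨ψ, hψ, fun z => ?_⟩
    rw [hψφ (mem_sphere_zero_iff_norm.2 z.norm_coe), hφs]
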